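/- Let $p\neq\ell$ be prime numbers, let $F\subset\overline{\mathbb Q}_p$ be a finite extension of $\mathbb Q_p$ with residue field of cardinality $q$, and put $\Gamma=\mathrm{Gal}(\overline{\mathbb Q}_p/F)$, with inertia subgroup $I$. Let $W\subset\Gamma$ be the Weil group of $F$, that is, the group of those elements of $\Gamma$ which act on the residue field of $\overline{\mathbb Q}_p$ as an integral power of $x\mapsto x^q$, with the topology for which $I$ (with its topology of subgroup of $\Gamma$) is an open subgroup. Let $\overline{\mathbb Z}_\ell$ be the ring of integers of $\overline{\mathbb Q}_\ell$ and $\overline{\mathbb F}_\ell$ its residue field. A finite-dimensional $\overline{\mathbb Q}_\ell$-representation of a group $G$ is called integral if it has a $G$-stable $\overline{\mathbb Z}_\ell$-lattice $L$ (a finitely generated $\overline{\mathbb Z}_\ell$-submodule spanning the space); its reduction mod $\ell$, denoted $\mathbf r_\ell$, is then the semisimplification of the representation of $G$ on $L\otimes_{\overline{\mathbb Z}_\ell}\overline{\mathbb F}_\ell$. Let $\sigma$ be a continuous representation of $\Gamma$ on a finite-dimensional $\overline{\mathbb Q}_\ell$-vector space $V$, and let $(\rho,N)$ be its associated Deligne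 representation: for a continuous surjective homomorphism $t:I\to\mathbb Z_\ell$ and a Frobenius element $\Phi\in W$, $N$ is the nilpotent endomorphism of $V$ such that $\sigma(x)=e^{t(x)N}$ for all $x$ in some open subgroup of $I$, and $\rho$ is the representation of $W$ on $V$ such that $$\rho(\Phi^a x)=\sigma(\Phi^a x)\,e^{-t(x)N},\qquad a\in\mathbb Z,\ x\in I.$$ Then, for any choice of $t$ and $\Phi$, the representation $\rho$ is smooth and integral, the representation $\sigma$ is integral, and $$\mathbf r_\ell(\rho)\simeq\mathbf r_\ell(\sigma)|_W,$$ whatever the stable lattices used to compute the two sides. -/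

import Mathlib

/-!
# Local Galois and Weil groups, Deligne representations, reduction mod `ℓ`

Notation used in the comments: `F` is a `p`-adic field, that is, a finite extension of `ℚ_p` inside
the fixed algebraic closure `ℚ̄_p = PadicAlgCl p`, and `Γ = Gal(ℚ̄_p / F)` with its Krull topology.
-/

open scoped DirectSum TensorProduct

noncomputable section

namespace LAdic

section Fields

variable (p : ℕ) [Fact p.Prime]

/-- The ring of integers `ℤ̄_p` of `ℚ̄_p`. -/
abbrev IntegerRing : ValuationSubring (PadicAlgCl p) :=
  (PadicAlgCl.valued p).v.valuationSubring

/-- The residue field `𝔽̄_p` of `ℤ̄_p`. -/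
abbrev ResidueFieldBar : Type := IsLocalRing.ResidueField (IntegerRing p)

end Fields

section Galois

variable {p : ℕ} [Fact p.Prime] (F : IntermediateField ℚ_[p] (PadicAlgCl p))

/-- The absolute Galois group `Γ = Gal(ℚ̄_p / F)`. -/
abbrev AbsGal : Type := PadicAlgCl p ≃ₐ[F] PadicAlgCl p

/-- The cardinality `q` of the residue field of `F`. -/
def residueCard : ℕ :=
  Nat.card (IsLocalRing.ResidueField ((IntegerRing p).comap (algebraMap F (PadicAlgCl p))))

variable {F} in
lemma norm_gal (γ : AbsGal F) (x : PadicAlgCl p) : ‖γ x‖ = ‖x‖ :=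
  (spectralNorm_eq_of_equiv (γ.restrictScalars ℚ_[p]) x).symm

variable {F} in
lemma gal_mem (γ : AbsGal F) {x : PadicAlgCl p} (hx : x ∈ IntegerRing p) :
    γ x ∈ IntegerRing p := by
  have h : (PadicAlgCl.valued p).v (γ x) = (PadicAlgCl.valued p).v x := by
    rw [PadicAlgCl.valuation_def, PadicAlgCl.valuation_def]
    exact NNReal.coe_injective (norm_gal γ x)
  rw [Valuation.mem_valuationSubring_iff] at hx ⊢
  rwa [h]

/-- The action of `Γ` on `ℤ̄_p`. -/
def galInt : AbsGal F →* RingAut (IntegerRing p) where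
  toFun γ :=
    { toFun := fun x => ⟨γ x, gal_mem γ x.2⟩
      invFun := fun x => ⟨γ⁻¹ x, gal_mem γ⁻¹ x.2⟩
      left_inv := fun x => Subtype.ext (γ.symm_apply_apply x)
      right_inv := fun x => Subtype.ext (γ.apply_symm_apply x)
      map_mul' := fun _ _ => Subtype.ext (map_mul γ _ _)
      map_add' := fun _ _ => Subtype.ext (map_add γ _ _) }
  map_one' := rfl
  map_mul' _ _ := rfl

/-- The action of `Γ` on the residue field `𝔽̄_p` of `ℚ̄_p`. -/
def galRes : AbsGal F →* RingAut (ResidueFieldBar p) :=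
  IsLocalRing.ResidueField.mapAut.comp (galInt F)

/-- The inertia subgroup `I` of `Γ`. -/
def inertia : Subgroup (AbsGal F) := (galRes F).ker

/-- The subgroup of `Γ` underlying the Weil group: those `γ` which act on the residue field `𝔽̄_p` as
an integral power `x ↦ x ^ (q ^ (n - m))` of the Frobenius automorphism `x ↦ x ^ q`. -/
def weilSubgroup : Subgroup (AbsGal F) where
  carrier := {γ | ∃ m n : ℕ, ∀ x : ResidueFieldBar p,
    (galRes F γ x) ^ (residueCard F ^ m) = x ^ (residueCard F ^ n)}
  one_mem' := ⟨0, 0, fun x => by simp⟩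
  mul_mem' := by
    rintro γ δ ⟨m, n, h⟩ ⟨m', n', h'⟩
    refine ⟨m + m', n' + n, fun x => ?_⟩
    rw [map_mul, RingAut.mul_apply, pow_add, pow_mul, h, ← pow_mul, mul_comm, pow_mul, h',
      ← pow_mul, ← pow_add]
  inv_mem' := by
    rintro γ ⟨m, n, h⟩
    refine ⟨n, m, fun x => ?_⟩
    rw [← h, ← RingAut.mul_apply, ← map_mul, mul_inv_cancel, map_one, RingAut.one_apply]

lemma inertia_le_weilSubgroup : inertia F ≤ weilSubgroup F := fun γ hγ =>
  ⟨0, 0, fun x => by rw [(MonoidHom.mem_ker).1 hγ, RingAut.one_apply]⟩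

/-- The Weil group `W` of `F`. -/
def WeilGroup : Type := weilSubgroup F

namespace WeilGroup

instance : Group (WeilGroup F) := inferInstanceAs (Group (weilSubgroup F))

/-- The inclusion `W → Γ`. -/
def incl : WeilGroup F →* AbsGal F := (weilSubgroup F).subtype

/-- The inclusion `I → W`. -/
def ofInertia : inertia F →* WeilGroup F := Subgroup.inclusion (inertia_le_weilSubgroup F)

/-- The topology of the Weil group (not the subspace topology of `Γ`): the coarsest one such that
the inclusion `W → Γ` and the projection from `W` to the discrete set `W / I` are continuous. In
other words, `I` is open in `W` and carries the topology of a subgroup of `Γ`. -/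
instance : TopologicalSpace (WeilGroup F) :=
  TopologicalSpace.induced (incl F) inferInstance ⊓
    TopologicalSpace.induced (fun w : WeilGroup F => (w : WeilGroup F ⧸ (ofInertia F).range)) ⊥

variable {F}

/-- `w` is a Frobenius element of `W`: it acts on the residue field `𝔽̄_p` as the arithmetic
Frobenius `x ↦ x ^ q` or as its inverse, the geometric Frobenius. -/
def IsFrobenius (w : WeilGroup F) : Prop :=
  (∀ x, galRes F (incl F w) x = x ^ residueCard F) ∨
    (∀ x, (galRes F (incl F w) x) ^ residueCard F = x)

end WeilGroup

end Galois

section Representations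

/-- A representation of a topological group is smooth if the stabilizer of any vector is open. -/
def IsSmooth {k G V : Type*} [Field k] [Group G] [TopologicalSpace G] [AddCommGroup V] [Module k V]
    (ρ : Representation k G V) : Prop :=
  ∀ v : V, IsOpen {g : G | ρ g v = v}

/-- A finite-dimensional representation over a topological field is continuous if all its matrix
coefficients are continuous, that is, if `G → GL_n(k)` is continuous in any basis. -/
def IsContinuous {k G V : Type*} [Field k] [TopologicalSpace k] [Group G] [TopologicalSpace G]
    [AddCommGroup V] [Module k V] (ρ : Representation k G V) : Prop :=
  ∀ (f : Module.Dual k V) (v : V), Continuous fun g : G => f (ρ g v)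

/-- The exponential `∑ N ^ i / i!` of a nilpotent endomorphism (over a field of characteristic `0`),
as a finite sum. -/
def expNilpotent {k V : Type*} [Field k] [AddCommGroup V] [Module k V] (N : Module.End k V) :
    Module.End k V :=
  ∑ i ∈ Finset.range (nilpotencyClass N), ((i.factorial : k)⁻¹) • N ^ i

/-- The `A`-module `S` is a semisimplification of the `A`-module (of finite length) `M`: it is
isomorphic to the direct sum of the successive quotients of a composition series of `M`. -/
def IsSemisimplification (A M S : Type*) [Ring A] [AddCommGroup M] [Module A M] [AddCommGroup S]
    [Module A S] : Prop :=
  ∃ s : CompositionSeries (Submodule A M), s.head = ⊥ ∧ s.last = ⊤ ∧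
    Nonempty (S ≃ₗ[A] ⨁ i : Fin s.length,
      (s i.succ : Submodule A M) ⧸ (s i.castSucc).submoduleOf (s i.succ))

/-- The representation `τ` is a semisimplification of the finite-dimensional representation `ρ`. -/
def IsSemisimplificationRep {k G V M : Type*} [Field k] [Group G] [AddCommGroup V] [Module k V]
    [AddCommGroup M] [Module k M] (ρ : Representation k G V) (τ : Representation k G M) : Prop :=
  IsSemisimplification (MonoidAlgebra k G) ρ.asModule τ.asModule

section Lattices

variable {O K G V : Type*} [CommRing O] [Field K] [Algebra O K] [Group G] [AddCommGroup V]
  [Module K V] [Module O V] [IsScalarTower O K V]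

/-- `L` is a `G`-stable `O`-lattice (finitely generated and spanning) in the representation `ρ`. -/
structure IsStableLattice (ρ : Representation K G V) (L : Submodule O V) : Prop where
  isLattice : L.IsLattice K
  stable : ∀ (g : G), ∀ v ∈ L, ρ g v ∈ L

/-- The action of `G` on a stable lattice. -/
def latticeRep (ρ : Representation K G V) (L : Submodule O V) (hL : IsStableLattice ρ L) :
    Representation O G L where
  toFun g := ((ρ g).restrictScalars O).restrict (hL.stable g)
  map_one' := by ext; simp
  map_mul' g h := LinearMap.ext fun v => Subtype.ext (LinearMap.congr_fun (map_mul ρ g h) (v : V))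

/-- The representation of `G` on `L ⊗ k`, where `L` is a stable lattice and `k` the residue field of
`O`. -/
def residualRep [IsLocalRing O] (ρ : Representation K G V) (L : Submodule O V)
    (hL : IsStableLattice ρ L) :
    Representation (IsLocalRing.ResidueField O) G (IsLocalRing.ResidueField O ⊗[O] L) where
  toFun g := (latticeRep ρ L hL g).baseChange _
  map_one' := by rw [map_one]; exact LinearMap.baseChange_one ..
  map_mul' g h := by rw [map_mul]; exact LinearMap.baseChange_mul ..

end Lattices

variable {ℓ : ℕ} [Fact ℓ.Prime] {G V : Type*} [Group G] [AddCommGroup V] [Module (PadicAlgCl ℓ) V]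

/-- An `ℓ`-adic representation is integral if it has a stable `ℤ̄_ℓ`-lattice. -/
def IsIntegral (ρ : Representation (PadicAlgCl ℓ) G V) : Prop :=
  ∃ L : Submodule (IntegerRing ℓ) V, IsStableLattice ρ L

/-- `τ` is a reduction mod `ℓ` of the `ℓ`-adic representation `ρ`: it is a semisimplification of
`L ⊗ 𝔽̄_ℓ` for some stable `ℤ̄_ℓ`-lattice `L` of `ρ`. -/
def IsReduction {M : Type*} [AddCommGroup M] [Module (ResidueFieldBar ℓ) M]
    (ρ : Representation (PadicAlgCl ℓ) G V) (τ : Representation (ResidueFieldBar ℓ) G M) : Prop :=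
  ∃ (L : Submodule (IntegerRing ℓ) V) (hL : IsStableLattice ρ L),
    IsSemisimplificationRep (residualRep ρ L hL) τ

end Representations

section Deligne

variable {p ℓ : ℕ} [Fact p.Prime] [Fact ℓ.Prime] {F : IntermediateField ℚ_[p] (PadicAlgCl p)}
  {V : Type*} [AddCommGroup V] [Module (PadicAlgCl ℓ) V]

/-- The value of `t : I → ℤ_ℓ` at `x`, as an element of `ℚ̄_ℓ`. -/
def tameValue (t : inertia F →* Multiplicative ℤ_[ℓ]) (x : inertia F) : PadicAlgCl ℓ :=
  algebraMap ℚ_[ℓ] (PadicAlgCl ℓ) ((Multiplicative.toAdd (t x) : ℤ_[ℓ]) : ℚ_[ℓ])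

/-- `(ρ, N)` is the Deligne representation of `W` associated with the representation `σ` of `Γ` and
with some choice of a continuous surjective homomorphism `t : I → ℤ_ℓ` and of a Frobenius element
`Φ`: the endomorphism `N` is nilpotent, `σ(x) = exp(t(x) N)` on an open subgroup of `I`, and
`ρ(Φ ^ a * x) = σ(Φ ^ a * x) exp(-t(x) N)` for all `a ∈ ℤ` and `x ∈ I`. -/
def IsDeligneRep (σ : Representation (PadicAlgCl ℓ) (AbsGal F) V)
    (ρ : Representation (PadicAlgCl ℓ) (WeilGroup F) V) (N : Module.End (PadicAlgCl ℓ) V) : Prop :=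
  ∃ (t : inertia F →* Multiplicative ℤ_[ℓ]) (Φ : WeilGroup F),
    Continuous t ∧ Function.Surjective t ∧ Φ.IsFrobenius ∧ IsNilpotent N ∧
    (∃ U : Subgroup (inertia F), IsOpen (U : Set (inertia F)) ∧
      ∀ x ∈ U, σ x = expNilpotent (tameValue t x • N)) ∧
    ∀ (a : ℤ) (x : inertia F),
      ρ (Φ ^ a * WeilGroup.ofInertia F x) =
        σ (WeilGroup.incl F (Φ ^ a * WeilGroup.ofInertia F x)) *
          expNilpotent (-tameValue t x • N)

end Deligne

end LAdic

end

/-! The point is to find one lattice `L`, stable under both `σ` and `ρ`, on which the two actions of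
`W` agree modulo `ℓ`. Comparing `σ` on inertia elements conjugate under `γ` and linearising the
exponentials gives `σ γ * N = c • (N * σ γ)` (`IsDeligneRep.exists_conj`). Since `Γ` is compact, `σ`
is integral (`IsContinuous.isIntegral`), so its operators are bounded and `‖c‖ ≤ 1`
(`norm_le_one_of_conj`). Starting from a `σ`-stable lattice, adding its images under the powers of a
large multiple of `N` keeps it stable and makes `exp(sN)` congruent to `1` modulo `ℓ` for every
integral `s` (`exists_stable_lattice_exp`). As `ρ(w)` is `σ(w)` times such an exponential, the
residual representation of `ρ` on `L` is the restriction to `W` of that of `σ`.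

Two general facts turn this equality into the statement. First, `W` is dense in `Γ` and the residual
representation of `σ` has open kernel, so `W` and `Γ` have the same image and a semisimplification
over `Γ` remains one over `W` (`IsSemisimplificationRep.comp`). Second, the semisimplified reduction
does not depend on the lattice (`isSemisimplificationRep_residualRep_iff`). The ring `ℤ̄_ℓ` has no
uniformizer, so two lattices are compared through adapted bases and a chain of elementary steps. In
each step the two reductions form a two-periodic exact sequence, hence have the same composition
factors. -/

noncomputable section

namespace LAdic

set_option linter.unusedSectionVars false

/-! ### Composition series and uniqueness of semisimplifications. -/

section Semisimplification

variable {A M M' S S' : Type*} [Ring A] [AddCommGroup M] [Module A M] [AddCommGroup M'] [Module A M']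
  [AddCommGroup S] [Module A S] [AddCommGroup S'] [Module A S']

/-- The successive quotients of a composition series of submodules. -/
abbrev seriesFactor (s : CompositionSeries (Submodule A M)) (i : Fin s.length) : Type _ :=
  (s i.succ : Submodule A M) ⧸ (s i.castSucc).submoduleOf (s i.succ)

lemma nonempty_directSum_equiv_of_factors {s : CompositionSeries (Submodule A M)}
    {t : CompositionSeries (Submodule A M')} (e : Fin s.length ≃ Fin t.length)
    (h : ∀ i, Nonempty (seriesFactor s i ≃ₗ[A] seriesFactor t (e i))) :
    Nonempty ((⨁ i, seriesFactor s i) ≃ₗ[A] ⨁ i, seriesFactor t i) := by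
  have h' : ∀ j, Nonempty (seriesFactor s (e.symm j) ≃ₗ[A] seriesFactor t j) := fun j => by
    have := h (e.symm j)
    rwa [e.apply_symm_apply] at this
  exact ⟨(DirectSum.lequivCongrLeft A e).trans
    (DFinsupp.mapRange.linearEquiv fun j => (h' j).some)⟩

/-- Two semisimplifications of the same module are isomorphic. -/
lemma IsSemisimplification.nonempty_equiv (h : IsSemisimplification A M S)
    (h' : IsSemisimplification A M S') : Nonempty (S ≃ₗ[A] S') := by
  obtain ⟨s, hs, hs', ⟨f⟩⟩ := h
  obtain ⟨t, ht, ht', ⟨g⟩⟩ := h'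
  obtain ⟨e, he⟩ := CompositionSeries.jordan_holder s t (hs.trans ht.symm) (hs'.trans ht'.symm)
  obtain ⟨k⟩ := nonempty_directSum_equiv_of_factors e fun i => ⟨(he i).linearEquiv⟩
  exact ⟨f.trans (k.trans g.symm)⟩

lemma IsSemisimplification.congr (h : IsSemisimplification A M S) (e : S' ≃ₗ[A] S) :
    IsSemisimplification A M S' := by
  obtain ⟨s, hs, hs', ⟨f⟩⟩ := h
  exact ⟨s, hs, hs', ⟨e.trans f⟩⟩

lemma IsSemisimplification.of_factors {s : CompositionSeries (Submodule A M)}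
    {t : CompositionSeries (Submodule A M')} (hs : s.head = ⊥) (hs' : s.last = ⊤)
    (ht : t.head = ⊥) (ht' : t.last = ⊤) (e : Fin s.length ≃ Fin t.length)
    (he : ∀ i, Nonempty (seriesFactor s i ≃ₗ[A] seriesFactor t (e i)))
    (h : IsSemisimplification A M S) : IsSemisimplification A M' S := by
  obtain ⟨k⟩ := nonempty_directSum_equiv_of_factors e he
  have h₀ : IsSemisimplification A M (⨁ i, seriesFactor s i) :=
    ⟨s, hs, hs', ⟨LinearEquiv.refl _ _⟩⟩
  obtain ⟨f⟩ := h.nonempty_equiv h₀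
  exact ⟨t, ht, ht', ⟨f.trans k⟩⟩

lemma nonempty_subquotient_equiv (f : M →ₗ[A] M') {X Y : Submodule A M} {X' Y' : Submodule A M'}
    (h₁ : ∀ y ∈ Y, f y ∈ Y') (h₂ : ∀ z ∈ Y', ∃ y ∈ Y, f y - z ∈ X')
    (h₃ : ∀ y ∈ Y, f y ∈ X' ↔ y ∈ X) :
    Nonempty ((Y ⧸ X.submoduleOf Y) ≃ₗ[A] Y' ⧸ X'.submoduleOf Y') := by
  let g : Y →ₗ[A] Y' ⧸ X'.submoduleOf Y' := (X'.submoduleOf Y').mkQ ∘ₗ f.restrict h₁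
  have hg : Function.Surjective g := by
    intro z
    obtain ⟨z, rfl⟩ := Submodule.mkQ_surjective _ z
    obtain ⟨y, hy, hz⟩ := h₂ z z.2
    exact ⟨⟨y, hy⟩, (Submodule.Quotient.eq _).2 hz⟩
  have hk : X.submoduleOf Y = LinearMap.ker g := by
    ext y
    change (y : M) ∈ X ↔ (X'.submoduleOf Y').mkQ (f.restrict h₁ y) = 0
    rw [Submodule.mkQ_apply, Submodule.Quotient.mk_eq_zero, ← h₃ y y.2]
    rfl
  exact ⟨(Submodule.quotEquivOfEq _ _ hk).trans (g.quotKerEquivOfSurjective hg)⟩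

lemma covBy_of_subquotient_equiv {X Y : Submodule A M} {X' Y' : Submodule A M'} (h : X ⋖ Y)
    (h' : X' ≤ Y') (e : Nonempty ((Y ⧸ X.submoduleOf Y) ≃ₗ[A] Y' ⧸ X'.submoduleOf Y')) :
    X' ⋖ Y' := by
  have : IsSimpleModule A (Y ⧸ X.submoduleOf Y) := (covBy_iff_quot_is_simple h.le).1 h
  exact (covBy_iff_quot_is_simple h').2 (IsSimpleModule.congr e.some.symm)

lemma exists_compositionSeries_between [IsNoetherian A M] [IsArtinian A M] {X Y : Submodule A M}
    (h : X ≤ Y) : ∃ s : CompositionSeries (Submodule A M), s.head = X ∧ s.last = Y := by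
  have : Fact (X ≤ Y) := ⟨h⟩
  obtain ⟨f, f0, n, hn⟩ := exists_covBy_seq_of_wellFoundedLT_wellFoundedGT (Set.Icc X Y)
  refine ⟨⟨n, fun i => (f i : Submodule A M), fun i => ?_⟩, ?_, ?_⟩
  -- An interval is order-connected, so a cover inside it is a cover in the whole lattice of
  -- submodules.
  · exact (Set.OrdConnected.apply_covBy_apply_iff (OrderEmbedding.subtype _)
      (by change (Set.range (Subtype.val : Set.Icc X Y → _)).OrdConnected
          rw [Subtype.range_coe]
          exact Set.ordConnected_Icc)).2 (hn.2 i i.2)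
  · exact congrArg Subtype.val f0.eq_bot
  · exact congrArg Subtype.val hn.1.eq_top

/-- Two modules which form a two-periodic exact sequence have the same semisimplifications. -/
lemma IsSemisimplification.of_periodic [IsNoetherian A M] [IsArtinian A M] (f : M' →ₗ[A] M)
    (g : M →ₗ[A] M') (hf : LinearMap.ker f = LinearMap.range g)
    (hg : LinearMap.ker g = LinearMap.range f) (h : IsSemisimplification A M S) :
    IsSemisimplification A M' S := by
  -- A composition series of `M` through `range f = ker g`. By exactness `M' / ker f ≃ range f` and
  -- `M / range f ≃ range g = ker f`, so `M'` has the same two blocks of factors, stacked in the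
  -- opposite order.
  obtain ⟨s, hs, hs'⟩ := exists_compositionSeries_between (bot_le (a := LinearMap.range f))
  obtain ⟨t, ht, ht'⟩ := exists_compositionSeries_between (le_top (a := LinearMap.range f))
  have hst : s.last = t.head := hs'.trans ht.symm
  have hf0 : ∀ x, f (g x) = 0 := fun x => by
    rw [← LinearMap.mem_ker, hf]; exact ⟨x, rfl⟩
  have es : ∀ i : Fin s.length, Nonempty (seriesFactor s i ≃ₗ[A]
      ((s i.succ).comap f ⧸ ((s i.castSucc).comap f).submoduleOf ((s i.succ).comap f))) := by
    intro i
    have key := nonempty_subquotient_equiv f (X := (s i.castSucc).comap f)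
      (Y := (s i.succ).comap f) (X' := s i.castSucc) (Y' := s i.succ) (fun y hy => hy)
      (fun z hz => ?_) (fun y _ => Iff.rfl)
    · exact ⟨key.some.symm⟩
    · obtain ⟨y, rfl⟩ : z ∈ LinearMap.range f := hs' ▸ s.le_last i.succ hz
      exact ⟨y, hz, by simp⟩
  have et : ∀ i : Fin t.length, Nonempty (seriesFactor t i ≃ₗ[A]
      ((t i.succ).map g ⧸ ((t i.castSucc).map g).submoduleOf ((t i.succ).map g))) := by
    intro i
    refine nonempty_subquotient_equiv g (fun y hy => Submodule.mem_map_of_mem hy) ?_ ?_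
    · rintro _ ⟨y, hy, rfl⟩
      exact ⟨y, hy, by simp⟩
    · refine fun y hy => ⟨?_, fun h => Submodule.mem_map_of_mem h⟩
      rintro ⟨x, hx, hxy⟩
      have h1 : y - x ∈ t i.castSucc := by
        have h2 : y - x ∈ LinearMap.ker g := by simp [hxy]
        rw [hg, ← ht] at h2
        exact t.head_le _ h2
      simpa using add_mem h1 hx
  let s' : CompositionSeries (Submodule A M') :=
    ⟨s.length, fun i => (s i).comap f, fun i =>
      covBy_of_subquotient_equiv (s.step i) (Submodule.comap_mono (s.lt_succ i).le) (es i)⟩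
  let t' : CompositionSeries (Submodule A M') :=
    ⟨t.length, fun i => (t i).map g, fun i =>
      covBy_of_subquotient_equiv (t.step i) (Submodule.map_mono (t.lt_succ i).le) (et i)⟩
  have hts : t'.last = s'.head := by
    have h1 : t'.last = (t.last).map g := rfl
    have h2 : s'.head = (s.head).comap f := rfl
    rw [h1, h2, ht', hs, Submodule.map_top, ← hf]
    rfl
  have h1 : t'.head = (t.head).map g := rfl
  have h2 : s'.last = (s.last).comap f := rfl
  have hcongr : ∀ {X Y X₁ Y₁ : Submodule A M} {X' Y' X₁' Y₁' : Submodule A M'}, X₁ = X → Y₁ = Y →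
      X₁' = X' → Y₁' = Y' → Nonempty ((Y ⧸ X.submoduleOf Y) ≃ₗ[A] Y' ⧸ X'.submoduleOf Y') →
      Nonempty ((Y₁ ⧸ X₁.submoduleOf Y₁) ≃ₗ[A] Y₁' ⧸ X₁'.submoduleOf Y₁') := by
    rintro _ _ _ _ _ _ _ _ rfl rfl rfl rfl h
    exact h
  -- The permutation of the factors exchanges the two blocks.
  let e : Fin (s.length + t.length) ≃ Fin (t.length + s.length) :=
    finSumFinEquiv.symm.trans ((Equiv.sumComm _ _).trans finSumFinEquiv)
  have he : ∀ i, e (Fin.castAdd _ i) = Fin.natAdd _ i := fun i => by simp [e]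
  have he' : ∀ i, e (Fin.natAdd _ i) = Fin.castAdd _ i := fun i => by simp [e]
  refine IsSemisimplification.of_factors (s := s.smash t hst) (t := t'.smash s' hts)
    (by rw [RelSeries.head_smash, hs]) (by rw [RelSeries.last_smash, ht'])
    (by rw [RelSeries.head_smash, h1, ht, ← hg]; exact LinearMap.le_ker_iff_map.1 le_rfl)
    (by rw [RelSeries.last_smash, h2, hs']; ext; simp) e (fun i => ?_) h
  change Fin (s.length + t.length) at i
  induction i using Fin.addCases with
  | left i =>
    exact hcongr (RelSeries.smash_castAdd hst i) (RelSeries.smash_succ_castAdd hst i)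
      ((congrArg (fun j : Fin (t.length + s.length) => t'.smash s' hts j.castSucc) (he i)).trans
        (RelSeries.smash_natAdd hts i))
      ((congrArg (fun j : Fin (t.length + s.length) => t'.smash s' hts j.succ) (he i)).trans
        (RelSeries.smash_succ_natAdd hts i)) (es i)
  | right i =>
    exact hcongr (RelSeries.smash_natAdd hst i) (RelSeries.smash_succ_natAdd hst i)
      ((congrArg (fun j : Fin (t.length + s.length) => t'.smash s' hts j.castSucc) (he' i)).trans
        (RelSeries.smash_castAdd hts i))
      ((congrArg (fun j : Fin (t.length + s.length) => t'.smash s' hts j.succ) (he' i)).trans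
        (RelSeries.smash_succ_castAdd hts i)) (et i)

end Semisimplification

/-! ### Restriction of semisimplifications along group homomorphisms. -/

section ChangeOfRings

variable {A B M M₁ S S₁ : Type*} [Ring A] [Ring B] [AddCommGroup M] [Module A M]
  [AddCommGroup M₁] [Module B M₁] [AddCommGroup S] [Module A S] [AddCommGroup S₁] [Module B S₁]

/-- If `B` acts on `M` through `φ : B → A` and the image of `φ` acts on `M` as the whole of `A`, the
semisimplifications over `A` are also semisimplifications over `B`. -/
lemma IsSemisimplification.of_ringHom (φ : B →+* A) (e : M ≃+ M₁) (he : ∀ b m, e (φ b • m) =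
    b • e m)
    (e' : S ≃+ S₁) (he' : ∀ b m, e' (φ b • m) = b • e' m) (hφ : ∀ a : A, ∃ b, ∀ m : M, a • m =
        φ b • m)
    (h : IsSemisimplification A M S) : IsSemisimplification B M₁ S₁ := by
  have hes : ∀ b m, e.symm (b • m) = φ b • e.symm m := fun b m => by
    rw [AddEquiv.symm_apply_eq, he, e.apply_symm_apply]
  have hes' : ∀ b m, e'.symm (b • m) = φ b • e'.symm m := fun b m => by
    rw [AddEquiv.symm_apply_eq, he', e'.apply_symm_apply]
  -- Every `a` acts on `M` as some `φ b`, so the `B`-stable subgroups are exactly the `A`-stable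
  -- ones.
  let Θ : Submodule A M ≃o Submodule B M₁ :=
    { toFun := fun X =>
        { X.toAddSubmonoid.comap (e.symm : M₁ →+ M) with
          smul_mem' := fun b m (hm : e.symm m ∈ X) => show e.symm (b • m) ∈ X by
            rw [hes]; exact X.smul_mem _ hm }
      invFun := fun X =>
        { X.toAddSubmonoid.comap (e : M →+ M₁) with
          smul_mem' := fun a m (hm : e m ∈ X) => show e (a • m) ∈ X by
            obtain ⟨b, hb⟩ := hφ a
            rw [hb, he]; exact X.smul_mem _ hm }
      left_inv := fun X => by
        ext m; change e.symm (e m) ∈ X ↔ _; simp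
      right_inv := fun X => by
        ext m; change e (e.symm m) ∈ X ↔ _; simp
      map_rel_iff' := by
        intro X Y
        refine ⟨fun h m hm => ?_, fun h m hm => h hm⟩
        have : e m ∈ _ := h (show e.symm (e m) ∈ X by simpa using hm)
        simpa using (show e.symm (e m) ∈ Y from this) }
  have hΘ : ∀ X m, m ∈ Θ X ↔ e.symm m ∈ X := fun X m => Iff.rfl
  obtain ⟨s, hs, hs', ⟨f⟩⟩ := h
  let t : CompositionSeries (Submodule B M₁) :=
    ⟨s.length, fun i => Θ (s i), fun i => (apply_covBy_apply_iff Θ).2 (s.step i)⟩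
  have ht : t.head = Θ s.head := rfl
  have ht' : t.last = Θ s.last := rfl
  let r : ∀ i : Fin s.length, (s i.succ : Submodule A M) ≃+ (Θ (s i.succ) : Submodule B M₁) :=
      fun i =>
    { toFun := fun x => ⟨e x, by rw [hΘ]; simp⟩
      invFun := fun x => ⟨e.symm x, x.2⟩
      left_inv := fun x => by simp
      right_inv := fun x => by simp
      map_add' := fun x y => by ext; simp }
  let q : ∀ i : Fin s.length, seriesFactor s i ≃+ seriesFactor t i := fun i =>
    QuotientAddGroup.congr _ _ (r i) (by
      ext x
      constructor
      · rintro ⟨y, hy, rfl⟩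
        change e.symm (e y) ∈ s i.castSucc
        rw [e.symm_apply_apply]
        exact hy
      · intro hx
        exact ⟨(r i).symm x, hx, (r i).apply_symm_apply x⟩)
  have hq : ∀ i b x, q i (φ b • x) = b • q i x := by
    intro i b x
    obtain ⟨x, rfl⟩ := Submodule.mkQ_surjective _ x
    change Submodule.Quotient.mk (r i (φ b • x)) = b • Submodule.Quotient.mk (r i x)
    rw [← Submodule.Quotient.mk_smul]
    congr 1
    exact Subtype.ext (he b x)
  let Q : (⨁ i, seriesFactor s i) ≃+ ⨁ i, seriesFactor t i := DFinsupp.mapRange.addEquiv q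
  have hQ : ∀ b x, Q (φ b • x) = b • Q x := by
    intro b x
    ext i
    exact hq i b (x i)
  refine ⟨t, by rw [ht, hs, map_bot], by rw [ht', hs', map_top], ⟨?_⟩⟩
  exact
    { e'.symm.trans (f.toAddEquiv.trans Q) with
      map_smul' := fun b x => by
        change Q (f (e'.symm (b • x))) = b • Q (f (e'.symm x))
        rw [hes', map_smul, hQ] }

variable {k G H V W : Type*} [Field k] [Group G] [Group H] [AddCommGroup V] [Module k V]
  [AddCommGroup W] [Module k W]

/-- The identity, from the module of a representation to the module of its restriction. -/
def asModuleComp (θ : Representation k G V) (φ : H →* G) :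
    θ.asModule ≃+ Representation.asModule (θ.comp φ) :=
  AddEquiv.refl θ.asModule

lemma mapDomain_smul (θ : Representation k G V) (φ : H →* G) (b : MonoidAlgebra k H)
    (m : θ.asModule) :
    asModuleComp θ φ (MonoidAlgebra.mapDomainRingHom k φ b • m) = b • asModuleComp θ φ m := by
  induction b using MonoidAlgebra.induction_linear with
  | zero => rw [map_zero, zero_smul, zero_smul, map_zero]
  | add x y hx hy => rw [map_add, add_smul, add_smul, map_add, hx, hy]
  | single g a =>
    rw [MonoidAlgebra.mapDomainRingHom_apply, MonoidAlgebra.mapDomain_single,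
      Representation.single_smul, Representation.single_smul]
    rfl

/-- The two group algebras have the same image in the endomorphisms of `V`, hence the same
submodules; restriction along an arbitrary `φ` could break simple factors. -/
lemma IsSemisimplificationRep.comp {ρ : Representation k G V} {τ : Representation k G W} (φ : H →* G)
    (hφ : ∀ g, ∃ h, ρ g = ρ (φ h)) (h : IsSemisimplificationRep ρ τ) :
    IsSemisimplificationRep (ρ.comp φ) (τ.comp φ) := by
  refine IsSemisimplification.of_ringHom (MonoidAlgebra.mapDomainRingHom k φ)
    (asModuleComp ρ φ)
    (mapDomain_smul ρ φ)
    (asModuleComp τ φ)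
    (mapDomain_smul τ φ) ?_ h
  intro a
  induction a using MonoidAlgebra.induction_linear with
  | zero => exact ⟨0, fun m => by simp⟩
  | add x y hx hy =>
    obtain ⟨b, hb⟩ := hx
    obtain ⟨c, hc⟩ := hy
    exact ⟨b + c, fun m => by rw [map_add, add_smul, add_smul, hb, hc]⟩
  | single g a =>
    obtain ⟨x, hx⟩ := hφ g
    refine ⟨MonoidAlgebra.single x a, fun m => ?_⟩
    rw [MonoidAlgebra.mapDomainRingHom_apply, MonoidAlgebra.mapDomain_single]
    rw [Representation.single_smul, Representation.single_smul, hx]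

/-- Equivalences of representations are isomorphisms of modules over the group algebra. -/
lemma nonempty_equiv_iff {ρ : Representation k G V} {τ : Representation k G W} :
    Nonempty (ρ.Equiv τ) ↔ Nonempty (ρ.asModule ≃ₗ[MonoidAlgebra k G] τ.asModule) := by
  constructor
  · rintro ⟨e⟩
    let f := Representation.IntertwiningMap.equivLinearMapAsModule ρ τ e.toIntertwiningMap
    exact ⟨LinearEquiv.ofBijective f e.toLinearEquiv.bijective⟩
  · rintro ⟨e⟩
    let f := (Representation.IntertwiningMap.equivLinearMapAsModule ρ τ).symm e.toLinearMap
    exact ⟨Representation.Equiv.mk (LinearEquiv.ofBijective f.toLinearMap e.bijective)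
      f.isIntertwining'⟩

end ChangeOfRings

/-! ### Adapted bases of two lattices over a valuation ring. -/

section LatticeBases

variable {O K V ι : Type*} [CommRing O] [IsDomain O] [ValuationRing O] [Field K] [Algebra O K]
  [IsFractionRing O K] [AddCommGroup V] [Module K V] [Module O V] [IsScalarTower O K V]

/-- The lattice `⊕ O a_i b_i` attached to a basis `b` and to weights `a`. -/
def diagLattice (O : Type*) [CommRing O] [Algebra O K] [Module O V] [IsScalarTower O K V]
    (b : Module.Basis ι K V) (a : ι → K) : Submodule O V where
  carrier := {x | ∀ i, ∃ o : O, b.repr x i = algebraMap O K o * a i}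
  zero_mem' := fun i => ⟨0, by simp⟩
  add_mem' := fun {x y} hx hy i => by
    obtain ⟨o, ho⟩ := hx i
    obtain ⟨o', ho'⟩ := hy i
    exact ⟨o + o', by simp [ho, ho', add_mul]⟩
  smul_mem' := fun r x hx i => by
    obtain ⟨o, ho⟩ := hx i
    refine ⟨r * o, ?_⟩
    rw [← algebraMap_smul K r x, map_smul, Finsupp.smul_apply, ho, smul_eq_mul, map_mul, mul_assoc]

lemma span_eq_diagLattice [Finite ι] (b : Module.Basis ι K V) (a : ι → K) :
    Submodule.span O (Set.range fun i => a i • b i) = diagLattice O b a := by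
  classical
  cases nonempty_fintype ι
  apply le_antisymm
  · rw [Submodule.span_le]
    rintro _ ⟨j, rfl⟩ i
    by_cases h : j = i
    · subst h
      exact ⟨1, by simp⟩
    · exact ⟨0, by simp [h]⟩
  · intro x hx
    choose o ho using hx
    rw [← b.sum_repr x]
    refine Submodule.sum_mem _ fun i _ => ?_
    rw [ho, mul_smul, algebraMap_smul]
    exact Submodule.smul_mem _ _ (Submodule.subset_span ⟨i, rfl⟩)

lemma exists_eq_algebraMap_mul {x c : K} (hc : c ≠ 0)
    (h : ValuationRing.valuation O K x ≤ ValuationRing.valuation O K c) :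
    ∃ o : O, x = algebraMap O K o * c := by
  have h1 : x / c ∈ (ValuationRing.valuation O K).integer := by
    rw [Valuation.mem_integer_iff, map_div₀]
    exact div_le_one_of_le₀ h zero_le
  obtain ⟨o, ho⟩ := (ValuationRing.mem_integer_iff O K _).1 h1
  exact ⟨o, by rw [ho, div_mul_cancel₀ _ hc]⟩

/-- The functional splits a line off both lattices at once: `O e` from `L` and `O c e` from `L'`. A
finitely generated torsion-free module over a valuation ring is free, so `L` has coordinates; `c` is
a coordinate of a generator of `L'` that divides all coordinates of all generators. -/
lemma exists_adapted_functional {L L' : Submodule O V} (hL : L.FG) (hL' : L'.FG)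
    (h : Submodule.span K (L : Set V) = Submodule.span K (L' : Set V)) (h0 : L ≠ ⊥) :
    ∃ (φ : V →ₗ[K] K) (e : V) (c : K), c ≠ 0 ∧ e ∈ L ∧ φ e = 1 ∧ c • e ∈ L' ∧
      (∀ x ∈ L, ∃ o : O, φ x = algebraMap O K o) ∧
      ∀ x ∈ L', ∃ o : O, φ x = algebraMap O K o * c := by
  classical
  have : Module.Finite O L := Module.Finite.iff_fg.2 hL
  have : Module.IsTorsionFree O V := Module.IsTorsionFree.trans_faithfulSMul O K V
  have : Module.Flat O L := Module.Flat.flat_iff_torsion_eq_bot_of_isBezout.2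
    (Submodule.isTorsionFree_iff_torsion_eq_bot.1 inferInstance)
  have : Module.Free O L := Module.free_of_flat_of_isLocalRing
  let bL := Module.Free.chooseBasis O L
  let v : Module.Free.ChooseBasisIndex O L → V := fun i => bL i
  have hv : LinearIndependent K v := by
    rw [← LinearIndependent.iff_fractionRing O K]
    exact bL.linearIndependent.map' L.subtype (Submodule.ker_subtype L)
  have hLv : L = Submodule.span O (Set.range v) := by
    have h1 := congrArg (Submodule.map L.subtype) bL.span_eq
    rw [Submodule.map_span, Submodule.map_top, Submodule.range_subtype, ← Set.range_comp] at h1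
    exact h1.symm
  have hsp : Submodule.span K (L : Set V) = Submodule.span K (Set.range v) := by
    have h1 := congrArg (fun X : Submodule O V => Submodule.span K (X : Set V)) hLv
    exact h1.trans (Submodule.span_span_of_tower O K _)
  have hφ : ∀ i, ∃ g : V →ₗ[K] K, ∀ x : Submodule.span K (Set.range v), g x = hv.repr x i :=
      fun i => by
    obtain ⟨g, hg⟩ := LinearMap.exists_extend (Finsupp.lapply i ∘ₗ hv.repr)
    exact ⟨g, fun x => LinearMap.congr_fun hg x⟩
  choose φ hφ using hφ
  have hsum : ∀ x ∈ Submodule.span K (Set.range v), x = ∑ i, φ i x • v i := by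
    intro x hx
    have h1 := hv.linearCombination_repr ⟨x, hx⟩
    rw [Finsupp.linearCombination_apply, Finsupp.sum_fintype _ _ (by simp)] at h1
    rw [← show _ = x from h1]
    exact Finset.sum_congr rfl fun i _ => by rw [← hφ i ⟨x, hx⟩, show _ = x from h1]
  have hφv : ∀ i j, φ i (v j) = if j = i then 1 else 0 := by
    intro i j
    have h1 := hφ i ⟨v j, Submodule.subset_span ⟨j, rfl⟩⟩
    rw [hv.repr_eq_single j _ rfl, Finsupp.single_apply] at h1
    exact h1
  obtain ⟨T, hT⟩ := hL'
  have hL'0 : L' ≠ ⊥ := by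
    rintro rfl
    apply h0
    rw [Submodule.bot_coe, Submodule.span_zero_singleton, Submodule.span_eq_bot] at h
    exact (Submodule.eq_bot_iff _).2 h
  have hTn : T.Nonempty := by
    rw [Finset.nonempty_iff_ne_empty]
    rintro rfl
    exact hL'0 (by simpa using hT.symm)
  have hιn : Nonempty (Module.Free.ChooseBasisIndex O L) := by
    by_contra hne
    rw [not_nonempty_iff] at hne
    exact h0 (by rw [hLv, Set.range_eq_empty, Submodule.span_empty])
  -- The largest valuation belongs to the least divisible coordinate. It will be `c`, and `e = c⁻¹
  -- g` then still has integral coordinates.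
  obtain ⟨⟨i, g⟩, hig, hmax⟩ := Finset.exists_max_image (Finset.univ ×ˢ T)
    (fun p => ValuationRing.valuation O K (φ p.1 p.2)) (Finset.univ_nonempty.product hTn)
  have hgT : g ∈ T := (Finset.mem_product.1 hig).2
  have hmem : ∀ x ∈ L', x ∈ Submodule.span K (Set.range v) := fun x hx => by
    rw [← hsp, h]; exact Submodule.subset_span hx
  set c := φ i g with hc_def
  have hc : c ≠ 0 := by
    intro hc
    apply hL'0
    rw [← hT, Submodule.span_eq_bot]
    intro x hx
    rw [hsum x (hmem x (hT ▸ Submodule.subset_span hx))]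
    refine Finset.sum_eq_zero fun j _ => ?_
    have h1 := hmax (j, x) (Finset.mem_product.2 ⟨Finset.mem_univ _, hx⟩)
    simp only at h1
    rw [hc, map_zero, le_zero_iff, Valuation.zero_iff] at h1
    rw [h1, zero_smul]
  have hint : ∀ j, ∀ x ∈ L', ∃ o : O, φ j x = algebraMap O K o * c := by
    intro j x hx
    rw [← hT] at hx
    induction hx using Submodule.span_induction with
    | mem x hx =>
      exact exists_eq_algebraMap_mul hc (hmax (j, x) (Finset.mem_product.2 ⟨Finset.mem_univ _, hx⟩))
    | zero => exact ⟨0, by simp⟩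
    | add x y _ _ hx hy =>
      obtain ⟨o, ho⟩ := hx
      obtain ⟨o', ho'⟩ := hy
      exact ⟨o + o', by rw [map_add, map_add, ho, ho', add_mul]⟩
    | smul r x _ hx =>
      obtain ⟨o, ho⟩ := hx
      exact ⟨r * o, by
        rw [← algebraMap_smul K r x, map_smul, ho, smul_eq_mul, map_mul, mul_assoc]⟩
  have hgL' : g ∈ L' := hT ▸ Submodule.subset_span hgT
  refine ⟨φ i, c⁻¹ • g, c, hc, ?_, ?_, ?_, ?_, hint i⟩
  · rw [hsum g (hmem g hgL'), Finset.smul_sum]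
    refine Submodule.sum_mem _ fun j _ => ?_
    obtain ⟨o, ho⟩ := hint j g hgL'
    rw [ho, smul_smul, mul_comm, mul_assoc, mul_inv_cancel₀ hc, mul_one, algebraMap_smul]
    exact L.smul_mem _ (bL j).2
  · rw [map_smul, ← hc_def, smul_eq_mul, inv_mul_cancel₀ hc]
  · rwa [smul_smul, mul_inv_cancel₀ hc, one_smul]
  · intro x hx
    rw [hLv] at hx
    induction hx using Submodule.span_induction with
    | mem x hx =>
      obtain ⟨j, rfl⟩ := hx
      rw [hφv]
      split_ifs
      · exact ⟨1, by simp⟩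
      · exact ⟨0, by simp⟩
    | zero => exact ⟨0, by simp⟩
    | add x y _ _ hx hy =>
      obtain ⟨o, ho⟩ := hx
      obtain ⟨o', ho'⟩ := hy
      exact ⟨o + o', by rw [map_add, map_add, ho, ho']⟩
    | smul r x _ hx =>
      obtain ⟨o, ho⟩ := hx
      exact ⟨r * o, by
        rw [← algebraMap_smul K r x, map_smul, ho, smul_eq_mul, map_mul]⟩

/-- Elementary divisors, by induction on the rank. The projection along `e` onto `ker φ` sends both
lattices to lattices in a smaller subspace; this is why only equality of the spans is assumed, and
not that they fill `V`. -/
lemma exists_joint_linearIndependent (n : ℕ) {L L' : Submodule O V} (hL : L.FG) (hL' : L'.FG)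
    (h : Submodule.span K (L : Set V) = Submodule.span K (L' : Set V))
    (hn : Module.finrank K (Submodule.span K (L : Set V)) ≤ n) :
    ∃ (m : ℕ) (b : Fin m → V) (a : Fin m → K), LinearIndependent K b ∧ (∀ i, a i ≠ 0) ∧
      L = Submodule.span O (Set.range b) ∧
      L' = Submodule.span O (Set.range fun i => a i • b i) := by
  have hbot : ∀ {L L' : Submodule O V}, Submodule.span K (L : Set V) =
      Submodule.span K (L' : Set V) →
      L = ⊥ → L' = ⊥ := by
    rintro _ L' h rfl
    rw [Submodule.bot_coe, Submodule.span_zero_singleton, eq_comm, Submodule.span_eq_bot] at h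
    exact (Submodule.eq_bot_iff _).2 h
  have hfin : ∀ {L : Submodule O V}, L.FG → Module.Finite K (Submodule.span K (L : Set V)) := by
    rintro L ⟨T, rfl⟩
    rw [Submodule.span_span_of_tower]
    exact FiniteDimensional.span_finset K T
  induction n generalizing L L' with
  | zero =>
    have := hfin hL
    have h1 := Submodule.finrank_eq_zero.1 (Nat.le_zero.1 hn)
    have h2 : L = ⊥ := (Submodule.eq_bot_iff _).2 (Submodule.span_eq_bot.1 h1)
    exact ⟨0, Fin.elim0, Fin.elim0, linearIndependent_empty_type, fun i => i.elim0,
      by simp [h2], by simp [hbot h h2]⟩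
  | succ n ih =>
    by_cases h0 : L = ⊥
    · exact ⟨0, Fin.elim0, Fin.elim0, linearIndependent_empty_type, fun i => i.elim0,
        by simp [h0], by simp [hbot h h0]⟩
    obtain ⟨φ, e, c, hc, heL, hφe, heL', hφL, hφL'⟩ := exists_adapted_functional hL hL' h h0
    let P : V →ₗ[K] V := LinearMap.id - φ.smulRight e
    have hP : ∀ x, P x = x - φ x • e := fun x => rfl
    have hφP : ∀ x, φ (P x) = 0 := fun x => by rw [hP, map_sub, map_smul, hφe]; simp
    have hspan : ∀ X : Submodule O V,
        Submodule.span K ((X.map (P.restrictScalars O) : Submodule O V) : Set V) =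
        (Submodule.span K (X : Set V)).map P := fun X => by
      rw [Submodule.map_span]; rfl
    have hle : (Submodule.span K (L : Set V)).map P < Submodule.span K (L : Set V) := by
      have heS : e ∈ Submodule.span K (L : Set V) := Submodule.subset_span heL
      refine lt_of_le_of_ne ?_ fun heq => ?_
      · rintro _ ⟨x, hx, rfl⟩
        exact Submodule.sub_mem _ hx (Submodule.smul_mem _ _ heS)
      · rw [← heq] at heS
        obtain ⟨x, -, hx⟩ := heS
        have := hφP x
        rw [hx, hφe] at this
        exact one_ne_zero this
    have := hfin hL
    obtain ⟨m, b, a, hb, ha, h1, h2⟩ := ih (L := L.map (P.restrictScalars O))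
      (L' := L'.map (P.restrictScalars O)) (hL.map _) (hL'.map _) (by rw [hspan, hspan, h])
      (by rw [hspan]; exact Nat.lt_succ_iff.1 ((Submodule.finrank_lt_finrank_of_lt hle).trans_le hn))
    have hbφ : ∀ x ∈ Submodule.span K (Set.range b), φ x = 0 := by
      intro x hx
      refine (Submodule.span_le (p := LinearMap.ker φ)).2 ?_ hx
      rintro _ ⟨i, rfl⟩
      have h3 : b i ∈ L.map (P.restrictScalars O) := h1 ▸ Submodule.subset_span ⟨i, rfl⟩
      obtain ⟨y, -, hy⟩ := h3
      rw [← hy]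
      exact hφP y
    -- Applied with `d = 1` to `L` and with `d = c` to `L'`.
    have hspanc : ∀ (X : Submodule O V) (d : K) (u : Fin m → V), d • e ∈ X →
        (∀ x ∈ X, ∃ o : O, φ x = algebraMap O K o * d) →
        X.map (P.restrictScalars O) = Submodule.span O (Set.range u) →
        X = Submodule.span O (Set.range (Fin.cons (d • e) u : Fin (m + 1) → V)) := by
      intro X d u hd hX hu
      have hPX : ∀ x ∈ X, ∃ o : O, P x = x - o • d • e := fun x hx => by
        obtain ⟨o, ho⟩ := hX x hx
        exact ⟨o, by rw [hP, ho, mul_smul, algebraMap_smul]⟩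
      rw [Fin.range_cons, Submodule.span_insert, ← hu]
      apply le_antisymm
      · intro x hx
        obtain ⟨o, ho⟩ := hPX x hx
        rw [Submodule.mem_sup]
        exact ⟨o • d • e, Submodule.smul_mem _ _ (Submodule.mem_span_singleton_self _), P x,
          ⟨x, hx, rfl⟩, by rw [ho]; abel⟩
      · refine sup_le ((Submodule.span_singleton_le_iff_mem _ _).2 hd) ?_
        rintro _ ⟨x, hx, rfl⟩
        obtain ⟨o, ho⟩ := hPX x hx
        change P x ∈ X
        rw [ho]
        exact X.sub_mem hx (X.smul_mem _ hd)
    refine ⟨m + 1, Fin.cons e b, Fin.cons c a, ?_, ?_, ?_, ?_⟩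
    · rw [linearIndependent_finCons]
      refine ⟨hb, fun he => ?_⟩
      have := hbφ e he
      rw [hφe] at this
      exact one_ne_zero this
    · intro i
      refine Fin.cases ?_ (fun j => ?_) i
      · exact hc
      · exact ha j
    · have := hspanc L 1 b (by rwa [one_smul]) (fun x hx => by
        obtain ⟨o, ho⟩ := hφL x hx
        exact ⟨o, by rw [ho, mul_one]⟩) h1
      rwa [one_smul] at this
    · have := hspanc L' c _ heL' hφL' h2
      convert this using 3
      ext i
      refine Fin.cases ?_ (fun j => ?_) i <;> simp

/-- Two lattices over a valuation ring have adapted bases. -/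
lemma exists_joint_basis (L L' : Submodule O V) (hL : L.IsLattice K) (hL' : L'.IsLattice K) :
    ∃ (m : ℕ) (b : Module.Basis (Fin m) K V) (a : Fin m → K), (∀ i, a i ≠ 0) ∧
      L = diagLattice O b 1 ∧ L' = diagLattice O b a := by
  obtain ⟨m, b, a, hb, ha, h1, h2⟩ := exists_joint_linearIndependent _ hL.fg hL'.fg
    (hL.span_eq_top.trans hL'.span_eq_top.symm) le_rfl
  have hs : ⊤ ≤ Submodule.span K (Set.range b) := by
    rw [← hL.span_eq_top, h1, Submodule.span_le]
    exact Submodule.span_le_restrictScalars O K _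
  refine ⟨m, Module.Basis.mk hb hs, a, ha, ?_, ?_⟩
  · rw [← span_eq_diagLattice, h1]; simp
  · rw [← span_eq_diagLattice, h2]; simp

end LatticeBases

/-! ### Reductions of two lattices that differ by an elementary step. -/

section Independence

variable {O K V ι G : Type*} [CommRing O] [IsDomain O] [ValuationRing O] [Field K] [Algebra O K]
  [IsFractionRing O K] [AddCommGroup V] [Module K V] [Module O V] [IsScalarTower O K V] [Group G]

lemma one_tmul_eq_zero_iff {L : Type*} [AddCommGroup L] [Module O L] (x : L) :
    (1 : IsLocalRing.ResidueField O) ⊗ₜ[O] x = 0 ↔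
      x ∈ IsLocalRing.maximalIdeal O • (⊤ : Submodule O L) := by
  have h := TensorProduct.quotTensorEquivQuotSMul_mk_tmul (M := L) (IsLocalRing.maximalIdeal O) 1 x
  rw [map_one, one_smul] at h
  rw [← Submodule.Quotient.mk_eq_zero, ← h]
  exact (LinearEquiv.map_eq_zero_iff _).symm

lemma tmul_eq_zero_iff [Finite ι] (b : Module.Basis ι K V) (a : ι → K) (x : diagLattice O b a) :
    (1 : IsLocalRing.ResidueField O) ⊗ₜ[O] x = 0 ↔
      ∀ i, ∃ o ∈ IsLocalRing.maximalIdeal O, b.repr (x : V) i = algebraMap O K o * a i := by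
  classical
  cases nonempty_fintype ι
  rw [one_tmul_eq_zero_iff]
  constructor
  · intro hx i
    induction hx using Submodule.smul_induction_on' with
    | smul r hr y _ =>
      obtain ⟨o, ho⟩ := y.2 i
      refine ⟨r * o, Ideal.mul_mem_right _ _ hr, ?_⟩
      rw [Submodule.coe_smul, ← algebraMap_smul K r (y : V), map_smul, Finsupp.smul_apply, ho,
        smul_eq_mul, map_mul, mul_assoc]
    | add y _ z _ hy hz =>
      obtain ⟨o, ho, h⟩ := hy
      obtain ⟨o', ho', h'⟩ := hz
      exact ⟨o + o', Ideal.add_mem _ ho ho', by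
        rw [Submodule.coe_add, map_add, Finsupp.add_apply, h, h', map_add, add_mul]⟩
  · intro h
    choose o ho h using h
    have hmem : ∀ i, a i • b i ∈ diagLattice O b a := fun i => by
      rw [← span_eq_diagLattice]; exact Submodule.subset_span ⟨i, rfl⟩
    have hx : x = ∑ i, o i • (⟨a i • b i, hmem i⟩ : diagLattice O b a) := by
      ext
      rw [← b.sum_repr (x : V), AddSubmonoidClass.coe_finsetSum]
      refine Finset.sum_congr rfl fun i _ => ?_
      rw [h, mul_smul, algebraMap_smul]
      rfl
    rw [hx]
    exact Submodule.sum_mem _ fun i _ => Submodule.smul_mem_smul (ho i) trivial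

lemma exists_eq_one_tmul {L : Type*} [AddCommGroup L] [Module O L]
    (z : IsLocalRing.ResidueField O ⊗[O] L) : ∃ x : L, z = 1 ⊗ₜ[O] x := by
  obtain ⟨x, hx⟩ := TensorProduct.mk_surjective O L (IsLocalRing.ResidueField O)
    IsLocalRing.residue_surjective z
  exact ⟨x, hx.symm⟩

/-- The `i`-th coordinate map with respect to a subset of a basis. -/
def coordProj [Finite ι] (b : Module.Basis ι K V) (p : ι → Prop) [DecidablePred p] : V →ₗ[K] V :=
  b.equivFun.symm.toLinearMap ∘ₗ
    LinearMap.pi (fun i => if p i then LinearMap.proj i else 0) ∘ₗ b.equivFun.toLinearMap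

lemma repr_coordProj [Finite ι] (b : Module.Basis ι K V) (p : ι → Prop) [DecidablePred p] (x : V)
    (i : ι) : b.repr (coordProj b p x) i = if p i then b.repr x i else 0 := by
  have := congrFun (b.equivFun.apply_symm_apply
    (fun i => (if p i then LinearMap.proj i else 0 : (ι → K) →ₗ[K] K) (b.equivFun x))) i
  rw [Module.Basis.equivFun_apply] at this
  refine this.trans ?_
  split_ifs <;> simp

/-- An equivariant map between stable lattices, at the level of residual representations. -/
def residualMap (ρ : Representation K G V) {L L' : Submodule O V} (hL : IsStableLattice ρ L)
    (hL' : IsStableLattice ρ L') (f : L →ₗ[O] L')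
    (hf : ∀ g x, f (latticeRep ρ L hL g x) = latticeRep ρ L' hL' g (f x)) :
    (residualRep ρ L hL).asModule →ₗ[MonoidAlgebra (IsLocalRing.ResidueField O) G]
      (residualRep ρ L' hL').asModule :=
  Representation.IntertwiningMap.equivLinearMapAsModule _ _
    { toLinearMap := f.baseChange _
      isIntertwining' := fun g => by
        have : f ∘ₗ latticeRep ρ L hL g = latticeRep ρ L' hL' g ∘ₗ f :=
          LinearMap.ext fun x => hf g x
        change f.baseChange _ ∘ₗ (latticeRep ρ L hL g).baseChange _ =
          (latticeRep ρ L' hL' g).baseChange _ ∘ₗ f.baseChange _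
        rw [← LinearMap.baseChange_comp, ← LinearMap.baseChange_comp, this] }

lemma residualMap_tmul (ρ : Representation K G V) {L L' : Submodule O V} (hL : IsStableLattice ρ L)
    (hL' : IsStableLattice ρ L') (f : L →ₗ[O] L')
    (hf : ∀ g x, f (latticeRep ρ L hL g x) = latticeRep ρ L' hL' g (f x)) (x : L) :
    residualMap ρ hL hL' f hf ((1 : IsLocalRing.ResidueField O) ⊗ₜ[O] x :
        IsLocalRing.ResidueField O ⊗[O] L) =
      ((1 : IsLocalRing.ResidueField O) ⊗ₜ[O] f x : IsLocalRing.ResidueField O ⊗[O] L') :=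
  LinearMap.baseChange_tmul f 1 x

/-- Every residual vector has the form `1 ⊗ x`, so exactness can be tested on lattice vectors. -/
lemma ker_residualMap_eq_range (ρ : Representation K G V) {L L' : Submodule O V}
    (hL : IsStableLattice ρ L) (hL' : IsStableLattice ρ L') (f : L →ₗ[O] L') (hf) (g : L' →ₗ[O] L) (hg)
    (h₁ : ∀ x, (1 : IsLocalRing.ResidueField O) ⊗ₜ[O] f (g x) = 0)
    (h₂ : ∀ x, (1 : IsLocalRing.ResidueField O) ⊗ₜ[O] f x = 0 →
      ∃ y, (1 : IsLocalRing.ResidueField O) ⊗ₜ[O] (x - g y) = 0) :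
    LinearMap.ker (residualMap ρ hL hL' f hf) = LinearMap.range (residualMap ρ hL' hL g hg) := by
  apply le_antisymm
  · intro z hz
    replace hz := LinearMap.mem_ker.1 hz
    obtain ⟨x, rfl⟩ := exists_eq_one_tmul (O := O) (L := L) z
    obtain ⟨y, hy⟩ := h₂ x ((residualMap_tmul ρ hL hL' f hf x).symm.trans hz)
    refine ⟨((1 : IsLocalRing.ResidueField O) ⊗ₜ[O] y : IsLocalRing.ResidueField O ⊗[O] L'), ?_⟩
    rw [TensorProduct.tmul_sub, sub_eq_zero] at hy
    exact (residualMap_tmul ρ hL' hL g hg y).trans hy.symm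
  · rintro _ ⟨z, rfl⟩
    apply LinearMap.mem_ker.2
    obtain ⟨x, rfl⟩ := exists_eq_one_tmul (O := O) (L := L') z
    exact (congrArg _ (residualMap_tmul ρ hL' hL g hg x)).trans
      ((residualMap_tmul ρ hL hL' f hf (g x)).trans (h₁ x))

lemma IsStableLattice.finite {ρ : Representation K G V} {L : Submodule O V}
    (hL : IsStableLattice ρ L) : Module.Finite O L :=
  Module.Finite.iff_fg.2 hL.isLattice.fg

lemma isNoetherian_residualRep {ρ : Representation K G V} {L : Submodule O V}
    (hL : IsStableLattice ρ L) :
    IsNoetherian (MonoidAlgebra (IsLocalRing.ResidueField O) G) (residualRep ρ L hL).asModule := by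
  have := hL.finite
  exact isNoetherian_of_tower (IsLocalRing.ResidueField O)
    (inferInstanceAs (IsNoetherian _ (IsLocalRing.ResidueField O ⊗[O] L)))

lemma isArtinian_residualRep {ρ : Representation K G V} {L : Submodule O V}
    (hL : IsStableLattice ρ L) :
    IsArtinian (MonoidAlgebra (IsLocalRing.ResidueField O) G) (residualRep ρ L hL).asModule := by
  have := hL.finite
  exact isArtinian_of_tower (IsLocalRing.ResidueField O)
    (inferInstanceAs (IsArtinian _ (IsLocalRing.ResidueField O ⊗[O] L)))

/-- Here `c L ⊆ L' ⊆ L`. After reduction, the inclusion `L' → L` is an isomorphism on the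
coordinates with `a' i = a i` and zero on the others, while multiplication by `c` from `L` to `L'`
does the opposite. The two maps therefore form a two-periodic exact sequence of `G`-modules. -/
lemma residual_iff_of_elementary [Finite ι] (ρ : Representation K G V) (b : Module.Basis ι K V)
    (a a' : ι → K) (c : O) (hc : c ∈ IsLocalRing.maximalIdeal O) (hc0 : c ≠ 0)
    (h : ∀ i, a' i = a i ∨ a' i = algebraMap O K c * a i)
    (hL : IsStableLattice ρ (diagLattice O b a)) (hL' : IsStableLattice ρ (diagLattice O b a'))
    {M : Type*} [AddCommGroup M] [Module (IsLocalRing.ResidueField O) M]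
    (τ : Representation (IsLocalRing.ResidueField O) G M) :
    IsSemisimplificationRep (residualRep ρ _ hL) τ ↔
      IsSemisimplificationRep (residualRep ρ _ hL') τ := by
  classical
  have hcK : algebraMap O K c ≠ 0 := by
    rwa [Ne, FaithfulSMul.algebraMap_eq_zero_iff]
  have hle : diagLattice O b a' ≤ diagLattice O b a := fun x hx i => by
    obtain ⟨o, ho⟩ := hx i
    rcases h i with h | h
    · exact ⟨o, by rw [ho, h]⟩
    · exact ⟨o * c, by rw [ho, h, map_mul, mul_assoc]⟩
  have hsm : ∀ x ∈ diagLattice O b a, c • x ∈ diagLattice O b a' := fun x hx i => by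
    obtain ⟨o, ho⟩ := hx i
    rw [← algebraMap_smul K c x, map_smul, Finsupp.smul_apply, ho, smul_eq_mul]
    rcases h i with h | h
    · exact ⟨c * o, by rw [h, map_mul, mul_assoc]⟩
    · exact ⟨o, by rw [h]; ring⟩
  let f : diagLattice O b a' →ₗ[O] diagLattice O b a := Submodule.inclusion hle
  let g : diagLattice O b a →ₗ[O] diagLattice O b a' := (LinearMap.lsmul O V c).restrict hsm
  have hf : ∀ γ x, f (latticeRep ρ _ hL' γ x) = latticeRep ρ _ hL γ (f x) := fun γ x => rfl
  have hg : ∀ γ x, g (latticeRep ρ _ hL γ x) = latticeRep ρ _ hL' γ (g x) := fun γ x =>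
    Subtype.ext (((ρ γ).restrictScalars O).map_smul c (x : V)).symm
  have hfg : ∀ x, f (g x) = c • x := fun x => rfl
  have hgf : ∀ x, g (f x) = c • x := fun x => rfl
  have hzero : ∀ {L : Submodule O V} (x : L), (1 : IsLocalRing.ResidueField O) ⊗ₜ[O] (c • x) = 0 :=
    fun x => (one_tmul_eq_zero_iff _).2 (Submodule.smul_mem_smul hc trivial)
  have k₁ : LinearMap.ker (residualMap ρ hL' hL f hf) =
      LinearMap.range (residualMap ρ hL hL' g hg) := by
    refine ker_residualMap_eq_range ρ hL' hL f hf g hg (fun x => by rw [hfg]; exact hzero x) ?_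
    intro x hx
    rw [tmul_eq_zero_iff] at hx
    -- On the coordinates where the weights differ, `x` is `c` times this vector; on the others,
    -- `hx` already puts `x` in the maximal ideal times the weight.
    have hy : coordProj b (fun i => a' i ≠ a i) ((algebraMap O K c)⁻¹ • (x : V)) ∈
        diagLattice O b a := by
      intro i
      rw [repr_coordProj]
      split_ifs with hi
      · obtain ⟨o, ho⟩ := x.2 i
        refine ⟨o, ?_⟩
        rw [map_smul, Finsupp.smul_apply, ho, (h i).resolve_left hi, smul_eq_mul]
        field_simp
      · exact ⟨0, by simp⟩
    refine ⟨⟨_, hy⟩, ?_⟩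
    rw [tmul_eq_zero_iff]
    intro i
    have e1 : b.repr ((x - g ⟨_, hy⟩ : diagLattice O b a') : V) i =
        if a' i ≠ a i then 0 else b.repr x i := by
      change b.repr ((x : V) - c • coordProj b _ ((algebraMap O K c)⁻¹ • (x : V))) i = _
      rw [← algebraMap_smul K c (coordProj _ _ _), ← map_smul, smul_smul, mul_inv_cancel₀ hcK,
          one_smul,
        map_sub, Finsupp.sub_apply, repr_coordProj]
      split_ifs <;> simp
    rw [e1]
    split_ifs with hi
    · exact ⟨0, zero_mem _, by simp⟩
    · obtain ⟨o, ho, e⟩ := hx i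
      exact ⟨o, ho, by rw [not_not.1 hi, ← e]; rfl⟩
  have k₂ : LinearMap.ker (residualMap ρ hL hL' g hg) =
      LinearMap.range (residualMap ρ hL' hL f hf) := by
    refine ker_residualMap_eq_range ρ hL hL' g hg f hf (fun x => by rw [hgf]; exact hzero x) ?_
    intro x hx
    rw [tmul_eq_zero_iff] at hx
    -- Where the weights agree, `x` itself lies in the smaller lattice; elsewhere `c` cancels from
    -- `hx`.
    have hy : coordProj b (fun i => a' i = a i) (x : V) ∈ diagLattice O b a' := by
      intro i
      rw [repr_coordProj]
      split_ifs with hi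
      · obtain ⟨o, ho⟩ := x.2 i
        exact ⟨o, by rw [ho, hi]⟩
      · exact ⟨0, by simp⟩
    refine ⟨⟨_, hy⟩, ?_⟩
    rw [tmul_eq_zero_iff]
    intro i
    have e1 : b.repr ((x - f ⟨_, hy⟩ : diagLattice O b a) : V) i = if a' i =
        a i then 0 else b.repr x i := by
      change b.repr ((x : V) - coordProj b _ (x : V)) i = _
      rw [map_sub, Finsupp.sub_apply, repr_coordProj]
      split_ifs <;> simp
    rw [e1]
    split_ifs with hi
    · exact ⟨0, zero_mem _, by simp⟩
    · obtain ⟨o, ho, e⟩ := hx i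
      refine ⟨o, ho, mul_left_cancel₀ hcK ?_⟩
      change b.repr (c • (x : V)) i = _ at e
      rw [← algebraMap_smul K c (x : V), map_smul, Finsupp.smul_apply, (h i).resolve_left hi,
        smul_eq_mul] at e
      rw [e]; ring
  have := isNoetherian_residualRep hL
  have := isNoetherian_residualRep hL'
  have := isArtinian_residualRep hL
  have := isArtinian_residualRep hL'
  exact ⟨fun H => IsSemisimplification.of_periodic _ _ k₁ k₂ H,
    fun H => IsSemisimplification.of_periodic _ _ k₂ k₁ H⟩

end Independence

/-! ### Independence of the reduction from the stable lattice. -/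

section IndependenceOfLattice

variable {O K V ι G : Type*} [CommRing O] [IsDomain O] [ValuationRing O] [Field K] [Algebra O K]
  [IsFractionRing O K] [AddCommGroup V] [Module K V] [Module O V] [IsScalarTower O K V] [Group G]

/-- A finite family in a valuation ring has a member which divides all others. -/
lemma exists_dvd_of_finset (a : ι → O) {s : Finset ι} (hs : s.Nonempty) :
    ∃ j ∈ s, ∀ i ∈ s, a j ∣ a i := by
  induction hs using Finset.Nonempty.cons_induction with
  | singleton i => exact ⟨i, by simp⟩
  | cons i s hi hs ih =>
    obtain ⟨j, hj, hj'⟩ := ih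
    rcases ValuationRing.dvd_total (a i) (a j) with hd | hd
    · refine ⟨i, by simp, fun k hk => ?_⟩
      rcases Finset.mem_cons.1 hk with rfl | hk
      · exact dvd_rfl
      · exact hd.trans (hj' k hk)
    · refine ⟨j, by simp [hj], fun k hk => ?_⟩
      rcases Finset.mem_cons.1 hk with rfl | hk
      · exact hd
      · exact hj' k hk

lemma diagLattice_eq_of_isUnit (b : Module.Basis ι K V) (w : ι → K) {a : ι → O}
    (hu : ∀ i, IsUnit (a i)) :
    diagLattice O b w = diagLattice O b fun i => algebraMap O K (a i) * w i := by
  ext x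
  refine forall_congr' fun i => ?_
  obtain ⟨u, hu⟩ := hu i
  constructor
  · rintro ⟨o, ho⟩
    refine ⟨o * (↑u⁻¹ : O), ?_⟩
    rw [ho]
    beta_reduce
    rw [← hu, ← mul_assoc, ← map_mul, mul_assoc, Units.inv_mul, mul_one]
  · rintro ⟨o, ho⟩
    exact ⟨o * a i, by rw [ho, map_mul, mul_assoc]⟩

/-- Induction on the number of non-unit ratios `a i`. Dividing all of these by one of them, `a j`,
that divides the others is an elementary step, and it turns the ratio at `j` into `1`. -/
lemma residual_iff_of_integral [Finite ι] (ρ : Representation K G V) (b : Module.Basis ι K V)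
    (n : ℕ) (w : ι → K) (a : ι → O) (ha : ∀ i, a i ≠ 0) (hn : {i | ¬ IsUnit (a i)}.ncard ≤ n)
    {L L' : Submodule O V} (hL : IsStableLattice ρ L) (hL' : IsStableLattice ρ L')
    (h : L = diagLattice O b w) (h' : L' = diagLattice O b fun i => algebraMap O K (a i) * w i)
    {M : Type*} [AddCommGroup M] [Module (IsLocalRing.ResidueField O) M]
    (τ : Representation (IsLocalRing.ResidueField O) G M) :
    IsSemisimplificationRep (residualRep ρ _ hL) τ ↔
      IsSemisimplificationRep (residualRep ρ _ hL') τ := by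
  classical
  induction n generalizing w a L with
  | zero =>
    obtain rfl : L = L' := by
      rw [h, h']
      refine diagLattice_eq_of_isUnit b w fun i => ?_
      rw [Nat.le_zero, Set.ncard_eq_zero (Set.toFinite _), Set.eq_empty_iff_forall_notMem] at hn
      exact not_not.1 (hn i)
    rfl
  | succ n ih =>
    by_cases hu : ∀ i, IsUnit (a i)
    · obtain rfl : L = L' := by
        rw [h, h']
        exact diagLattice_eq_of_isUnit b w hu
      rfl
    push Not at hu
    obtain ⟨i₀, hi₀⟩ := hu
    obtain ⟨j, hj, hj'⟩ := exists_dvd_of_finset a (s :=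
        (Set.toFinite {i | ¬ IsUnit (a i)}).toFinset) ⟨i₀, by simpa using hi₀⟩
    simp only [Set.Finite.mem_toFinset, Set.mem_ofPred_eq] at hj hj'
    have haK : ∀ i, algebraMap O K (a i) ≠ 0 := fun i => by
      rw [Ne, FaithfulSMul.algebraMap_eq_zero_iff]; exact ha i
    have hdec : ∀ i, ∃ o : O, a i = o * (if IsUnit (a i) then 1 else a j) := fun i => by
      split_ifs with hi
      · exact ⟨a i, by simp⟩
      · obtain ⟨o, ho⟩ := hj' i hi
        exact ⟨o, by rw [ho, mul_comm]⟩
    choose a₁ ha₁ using hdec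
    let w₁ : ι → K := fun i => (if IsUnit (a i) then 1 else algebraMap O K (a j)) * w i
    have hw₁ : ∀ i, algebraMap O K (a i) * w i = algebraMap O K (a₁ i) * w₁ i := fun i => by
      simp only [w₁]
      conv_lhs => rw [ha₁ i]
      split_ifs <;> simp [mul_assoc]
    -- The basis is unrelated to `G`; this description of the intermediate lattice, as `L' + a j L`,
    -- is what makes it stable.
    have hsup : diagLattice O b w₁ = L' ⊔ L.map (LinearMap.lsmul O V (a j)) := by
      apply le_antisymm
      · intro x hx
        rw [Submodule.mem_sup]
        refine ⟨coordProj b (fun i => IsUnit (a i)) x, ?_,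
          x - coordProj b (fun i => IsUnit (a i)) x,
          ⟨(algebraMap O K (a j))⁻¹ • (x - coordProj b (fun i => IsUnit (a i)) x), ?_, ?_⟩, by abel⟩
        · rw [h']
          intro i
          rw [repr_coordProj]
          split_ifs with hi
          · obtain ⟨o, ho⟩ := hx i
            obtain ⟨u, hu⟩ := hi
            refine ⟨o * (↑u⁻¹ : O), ?_⟩
            simp only [w₁] at ho
            rw [if_pos ⟨u, hu⟩, one_mul] at ho
            rw [ho]
            beta_reduce
            rw [← hu, ← mul_assoc, ← map_mul, mul_assoc, Units.inv_mul, mul_one]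
          · exact ⟨0, by simp⟩
        · rw [h]
          intro i
          rw [map_smul, Finsupp.smul_apply, map_sub, Finsupp.sub_apply, repr_coordProj]
          split_ifs with hi
          · exact ⟨0, by simp⟩
          · obtain ⟨o, ho⟩ := hx i
            simp only [w₁] at ho
            rw [if_neg hi] at ho
            have := haK j
            exact ⟨o, by rw [ho, smul_eq_mul]; field_simp; ring⟩
        · rw [LinearMap.lsmul_apply, ← algebraMap_smul K (a j), smul_smul, mul_inv_cancel₀ (haK j),
            one_smul]
      · refine sup_le ?_ ?_
        · rw [h']
          intro x hx i
          obtain ⟨o, ho⟩ := hx i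
          exact ⟨o * a₁ i, by rw [ho]; beta_reduce; rw [hw₁, map_mul, mul_assoc]⟩
        · rw [h]
          rintro _ ⟨x, hx, rfl⟩ i
          obtain ⟨o, ho⟩ := hx i
          rw [LinearMap.lsmul_apply, ← algebraMap_smul K (a j), map_smul, Finsupp.smul_apply, ho,
            smul_eq_mul]
          simp only [w₁]
          split_ifs
          · exact ⟨a j * o, by rw [map_mul, one_mul, mul_assoc]⟩
          · exact ⟨o, by ring⟩
    have hL₁ : IsStableLattice ρ (diagLattice O b w₁) := by
      rw [hsup]
      refine ⟨⟨hL'.isLattice.fg.sup (hL.isLattice.fg.map _), ?_⟩, ?_⟩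
      · rw [← top_le_iff, ← hL'.isLattice.span_eq_top]
        exact Submodule.span_mono (le_sup_left (a := L'))
      · intro γ v hv
        obtain ⟨x, hx, _, ⟨y, hy, rfl⟩, rfl⟩ := Submodule.mem_sup.1 hv
        rw [map_add]
        refine Submodule.add_mem_sup (hL'.stable γ x hx) ⟨ρ γ y, hL.stable γ y hy, ?_⟩
        exact (((ρ γ).restrictScalars O).map_smul (a j) y).symm
    have hstep : IsSemisimplificationRep (residualRep ρ _ hL) τ ↔
        IsSemisimplificationRep (residualRep ρ _ hL₁) τ := by
      subst h
      refine residual_iff_of_elementary ρ b w w₁ (a j) ((IsLocalRing.mem_maximalIdeal _).2 hj)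
        (ha j) (fun i => ?_) hL hL₁ τ
      simp only [w₁]
      split_ifs
      · left; rw [one_mul]
      · right; rfl
    refine hstep.trans (ih w₁ a₁ (fun i hi => ha i (by rw [ha₁ i, hi, zero_mul])) ?_ hL₁ rfl ?_)
    · have hsub : {i | ¬ IsUnit (a₁ i)} ⊂ {i | ¬ IsUnit (a i)} := by
        refine ⟨fun i hi hi' => hi ?_, fun hle => hle hj ?_⟩
        · have := ha₁ i
          rw [if_pos hi', mul_one] at this
          rwa [← this]
        · have := ha₁ j
          rw [if_neg hj] at this
          have h1 : a₁ j = 1 := mul_right_cancel₀ (ha j) (by rw [← this, one_mul])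
          rw [h1]
          exact isUnit_one
      exact Nat.lt_succ_iff.1 ((Set.ncard_lt_ncard hsub (Set.toFinite _)).trans_le hn)
    · rw [h']
      congr 1
      exact funext hw₁

/-- The semisimplification of the residual representation does not depend on the stable lattice. -/
theorem isSemisimplificationRep_residualRep_iff (ρ : Representation K G V) {L L' : Submodule O V}
    (hL : IsStableLattice ρ L) (hL' : IsStableLattice ρ L')
    {M : Type*} [AddCommGroup M] [Module (IsLocalRing.ResidueField O) M]
    (τ : Representation (IsLocalRing.ResidueField O) G M) :
    IsSemisimplificationRep (residualRep ρ L hL) τ ↔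
      IsSemisimplificationRep (residualRep ρ L' hL') τ := by
  obtain ⟨m, b, a, ha, h, h'⟩ := exists_joint_basis L L' hL.isLattice hL'.isLattice
  -- The scalar `d` clears the denominators of the weights, so `L` can be compared with `d L'`. If
  -- `d` is not a unit, passing from `L'` to `d L'` is an elementary step that scales every
  -- coordinate.
  obtain ⟨⟨d, hd⟩, hda⟩ := IsLocalization.exist_integer_multiples_of_finite (nonZeroDivisors O) a
  choose a₁ ha₁ using hda
  have hd0 : d ≠ 0 := nonZeroDivisors.ne_zero hd
  have hdK : algebraMap O K d ≠ 0 := by rwa [Ne, FaithfulSMul.algebraMap_eq_zero_iff]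
  have ha₁' : ∀ i, algebraMap O K (a₁ i) = algebraMap O K d * a i := fun i => by
    rw [ha₁, Algebra.smul_def]
  have ha₁0 : ∀ i, a₁ i ≠ 0 := fun i hi => by
    have := ha₁' i
    rw [hi, map_zero, eq_comm, mul_eq_zero] at this
    exact this.elim hdK (ha i)
  by_cases hu : IsUnit d
  · obtain ⟨u, rfl⟩ := hu
    have hua : ∀ i, algebraMap O K (↑u⁻¹ * a₁ i) = a i := fun i => by
      rw [map_mul, ha₁', ← mul_assoc, ← map_mul, Units.inv_mul, map_one, one_mul]
    exact residual_iff_of_integral ρ b _ 1 (fun i => ↑u⁻¹ * a₁ i)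
      (fun i => mul_ne_zero (Units.ne_zero _) (ha₁0 i)) le_rfl hL hL' h
      (by rw [h']; congr 1; ext i; rw [hua]; simp) τ
  · have hmap : diagLattice O b (fun i => algebraMap O K d * a i) =
        L'.map (LinearMap.lsmul O V d) := by
      rw [h']
      ext x
      constructor
      · intro hx
        refine ⟨(algebraMap O K d)⁻¹ • x, fun i => ?_, ?_⟩
        · obtain ⟨o, ho⟩ := hx i
          exact ⟨o, by rw [map_smul, Finsupp.smul_apply, ho, smul_eq_mul]; field_simp⟩
        · rw [LinearMap.lsmul_apply, ← algebraMap_smul K d, smul_smul, mul_inv_cancel₀ hdK,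
            one_smul]
      · rintro ⟨y, hy, rfl⟩ i
        obtain ⟨o, ho⟩ := hy i
        refine ⟨o, ?_⟩
        rw [LinearMap.lsmul_apply, ← algebraMap_smul K d, map_smul, Finsupp.smul_apply, ho,
          smul_eq_mul]
        ring
    have hLd : IsStableLattice ρ (diagLattice O b fun i => algebraMap O K d * a i) := by
      rw [hmap]
      refine ⟨⟨hL'.isLattice.fg.map _, ?_⟩, ?_⟩
      · rw [← top_le_iff, ← hL'.isLattice.span_eq_top, Submodule.span_le]
        intro x hx
        have : x = (algebraMap O K d)⁻¹ • (d • x) := by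
          rw [← algebraMap_smul K d, smul_smul, inv_mul_cancel₀ hdK, one_smul]
        rw [this]
        exact Submodule.smul_mem _ _ (Submodule.subset_span ⟨x, hx, rfl⟩)
      · rintro γ _ ⟨y, hy, rfl⟩
        exact ⟨ρ γ y, hL'.stable γ y hy, (((ρ γ).restrictScalars O).map_smul d y).symm⟩
    refine (residual_iff_of_integral ρ b _ 1 a₁ ha₁0 le_rfl hL hLd h
      (by congr 1; ext i; rw [ha₁']; simp) τ).trans ?_
    subst h'
    exact (residual_iff_of_elementary ρ b a _ d ((IsLocalRing.mem_maximalIdeal _).2 hu) hd0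
      (fun i => Or.inr rfl) hL' hLd τ).symm

end IndependenceOfLattice

/-! ### The residue field of `ℚ̄_p`. -/

section ResidueField

variable {p : ℕ} [Fact p.Prime]

lemma mem_integerRing {x : PadicAlgCl p} : x ∈ IntegerRing p ↔ ‖x‖ ≤ 1 := by
  rw [Valuation.mem_valuationSubring_iff, PadicAlgCl.valuation_def, ← NNReal.coe_le_coe]
  rfl

lemma mem_maximalIdeal_integerRing {x : IntegerRing p} :
    x ∈ IsLocalRing.maximalIdeal (IntegerRing p) ↔ ‖(x : PadicAlgCl p)‖ < 1 := by
  rw [IsLocalRing.mem_maximalIdeal, mem_nonunits_iff]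
  have hx := mem_integerRing.1 x.2
  constructor
  · intro h
    refine lt_of_le_of_ne hx fun h1 => h ?_
    have h0 : (x : PadicAlgCl p) ≠ 0 := fun h0 => by rw [h0, norm_zero] at h1; exact zero_ne_one h1
    refine IsUnit.of_mul_eq_one ⟨(x : PadicAlgCl p)⁻¹, mem_integerRing.2 ?_⟩
      (Subtype.ext (mul_inv_cancel₀ h0))
    rw [norm_inv, h1, inv_one]
  · intro h hu
    obtain ⟨y, hy⟩ := hu.exists_right_inv
    have h1 : ‖(x : PadicAlgCl p)‖ * ‖(y : PadicAlgCl p)‖ = 1 := by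
      rw [← norm_mul]
      exact (congrArg norm (congrArg Subtype.val hy)).trans norm_one
    have h2 := mem_integerRing.1 y.2
    nlinarith [norm_nonneg (x : PadicAlgCl p), norm_nonneg (y : PadicAlgCl p)]

lemma residue_eq_iff {x y : IntegerRing p} :
    IsLocalRing.residue (IntegerRing p) x = IsLocalRing.residue (IntegerRing p) y ↔
      ‖(x : PadicAlgCl p) - y‖ < 1 := by
  rw [← sub_eq_zero, ← map_sub, IsLocalRing.residue_eq_zero_iff, mem_maximalIdeal_integerRing]
  rfl

/-- The closed unit ball of `E` is compact, hence covered by finitely many open balls of radius `1`,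
and points of one such ball have the same residue. -/
lemma finite_residues (E : IntermediateField ℚ_[p] (PadicAlgCl p)) [FiniteDimensional ℚ_[p] E] :
    {z : ResidueFieldBar p | ∃ x : IntegerRing p, (x : PadicAlgCl p) ∈ E ∧
      IsLocalRing.residue _ x = z}.Finite := by
  classical
  have : FiniteDimensional ℚ_[p] E.toSubalgebra.toSubmodule :=
    inferInstanceAs (FiniteDimensional ℚ_[p] E)
  have : ProperSpace E.toSubalgebra.toSubmodule := FiniteDimensional.proper ℚ_[p] _
  obtain ⟨t, ht, htf, hcov⟩ :=
    (isCompact_closedBall (0 : E.toSubalgebra.toSubmodule) 1).finite_cover_balls one_pos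
  refine (htf.image fun y : E.toSubalgebra.toSubmodule =>
    if h : (y : PadicAlgCl p) ∈ IntegerRing p then
      IsLocalRing.residue (IntegerRing p) ⟨y, h⟩ else 0).subset ?_
  rintro z ⟨x, hxE, rfl⟩
  have hx : (⟨x, hxE⟩ : E.toSubalgebra.toSubmodule) ∈ Metric.closedBall 0 1 := by
    rw [mem_closedBall_zero_iff]
    exact mem_integerRing.1 x.2
  obtain ⟨y, hyt, hy⟩ := Set.mem_iUnion₂.1 (hcov hx)
  have hyO : (y : PadicAlgCl p) ∈ IntegerRing p :=
    mem_integerRing.2 (mem_closedBall_zero_iff.1 (ht hyt))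
  refine ⟨y, hyt, ?_⟩
  simp only [dif_pos hyO]
  rw [residue_eq_iff, ← norm_neg, neg_sub]
  rw [Metric.mem_ball, dist_eq_norm] at hy
  exact hy

/-- The powers of a residue stay in the finite set of residues of one finite extension, so two of
them coincide. -/
lemma residue_isIntegral {R : Type*} [Field R] [Algebra R (ResidueFieldBar p)]
    (z : ResidueFieldBar p) : _root_.IsIntegral R z := by
  obtain ⟨x, rfl⟩ := IsLocalRing.residue_surjective z
  have : FiniteDimensional ℚ_[p] (IntermediateField.adjoin ℚ_[p] {(x : PadicAlgCl p)}) :=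
    IntermediateField.adjoin.finiteDimensional (Algebra.IsIntegral.isIntegral _)
  have hfin := finite_residues (IntermediateField.adjoin ℚ_[p] {(x : PadicAlgCl p)})
  have hmem : ∀ n : ℕ, IsLocalRing.residue (IntegerRing p) x ^ n ∈
      {z : ResidueFieldBar p | ∃ y : IntegerRing p,
        (y : PadicAlgCl p) ∈ IntermediateField.adjoin ℚ_[p] {(x : PadicAlgCl p)} ∧
          IsLocalRing.residue _ y = z} := fun n =>
    ⟨x ^ n, pow_mem (IntermediateField.mem_adjoin_simple_self ℚ_[p] (x : PadicAlgCl p)) n,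
      map_pow _ _ _⟩
  obtain ⟨m, n, hmn, h⟩ := Set.Finite.exists_lt_map_eq_of_forall_mem hmem hfin
  refine ⟨Polynomial.X ^ n - Polynomial.X ^ m, Polynomial.monic_X_pow_sub ?_, ?_⟩
  · rw [Polynomial.degree_X_pow]; exact_mod_cast hmn
  · simp [h]

end ResidueField

/-! ### Structure of the Weil group and its density in the Galois group. -/

section WeilDensity

variable {p : ℕ} [Fact p.Prime] (F : IntermediateField ℚ_[p] (PadicAlgCl p))

/-- The ring of integers of `F`, mapped to that of `ℚ̄_p`. -/
def integersMap : (IntegerRing p).comap (algebraMap F (PadicAlgCl p)) →+* IntegerRing p where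
  toFun x := ⟨algebraMap F (PadicAlgCl p) x, x.2⟩
  map_one' := rfl
  map_mul' _ _ := rfl
  map_zero' := rfl
  map_add' _ _ := rfl

instance : IsLocalHom (integersMap F) where
  map_nonunit x hx := by
    obtain ⟨y, hy⟩ := hx.exists_right_inv
    have h1 : algebraMap F (PadicAlgCl p) x * y = 1 := congrArg Subtype.val hy
    have h0 : (x : F) ≠ 0 := fun h0 => by rw [h0, map_zero, zero_mul] at h1; exact zero_ne_one h1
    refine IsUnit.of_mul_eq_one ⟨(x : F)⁻¹, ?_⟩ (Subtype.ext (mul_inv_cancel₀ h0))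
    rw [ValuationSubring.mem_comap, map_inv₀, ← eq_inv_of_mul_eq_one_right h1]
    exact y.2

/-- The residue field of `F`, as a subfield of the residue field of `ℚ̄_p`. -/
def residueSubfield : Subfield (ResidueFieldBar p) :=
  (IsLocalRing.ResidueField.map (integersMap F)).fieldRange

lemma card_residueSubfield : Nat.card (residueSubfield F) = residueCard F :=
  (Nat.card_congr (Equiv.ofInjective _
    (IsLocalRing.ResidueField.map (integersMap F)).injective)).symm

lemma exists_of_mem_residueSubfield {z : ResidueFieldBar p} (hz : z ∈ residueSubfield F) :
    ∃ x : IntegerRing p, (x : PadicAlgCl p) ∈ F ∧ IsLocalRing.residue _ x = z := by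
  obtain ⟨y, rfl⟩ := hz
  obtain ⟨x, rfl⟩ := IsLocalRing.residue_surjective y
  exact ⟨integersMap F x, x.1.2, rfl⟩

lemma finite_residueSubfield [FiniteDimensional ℚ_[p] F] : Finite (residueSubfield F) :=
  ((finite_residues F).subset fun _ hz => exists_of_mem_residueSubfield F hz).to_subtype

variable {F}

lemma galRes_residue (γ : AbsGal F) (x : IntegerRing p) :
    galRes F γ (IsLocalRing.residue _ x) = IsLocalRing.residue _ (galInt F γ x) := rfl

lemma galRes_fix (γ : AbsGal F) {z : ResidueFieldBar p} (hz : z ∈ residueSubfield F) :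
    galRes F γ z = z := by
  obtain ⟨x, hx, rfl⟩ := exists_of_mem_residueSubfield F hz
  rw [galRes_residue]
  congr 1
  exact Subtype.ext (γ.commutes ⟨x, hx⟩)

/-- On a finite set, every element of `Γ` acts as a power of the Frobenius automorphism. -/
lemma exists_galRes_eq_pow [FiniteDimensional ℚ_[p] F] (γ : AbsGal F)
    (T : Finset (ResidueFieldBar p)) :
    ∃ n : ℕ, ∀ z ∈ T, galRes F γ z = z ^ residueCard F ^ n := by
  have := finite_residueSubfield F
  have : Fintype (residueSubfield F) := Fintype.ofFinite _
  let E := IntermediateField.adjoin (residueSubfield F) (T : Set (ResidueFieldBar p))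
  have : FiniteDimensional (residueSubfield F) E :=
    IntermediateField.finiteDimensional_adjoin fun z _ => residue_isIntegral z
  have : Finite E := Module.finite_of_finite (residueSubfield F)
  let g : ResidueFieldBar p ≃ₐ[residueSubfield F] ResidueFieldBar p :=
    AlgEquiv.ofRingEquiv (f := galRes F γ) fun z => galRes_fix γ z.2
  -- The finitely many elements of `T` generate a finite field, whose automorphisms over the residue
  -- field of `F` are powers of Frobenius.
  obtain ⟨n, hn⟩ := (FiniteField.bijective_frobeniusAlgEquivOfAlgebraic_pow (residueSubfield F) E).2
    (g.restrictNormal E)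
  refine ⟨n, fun z hz => ?_⟩
  have h1 := g.restrictNormal_commutes E ⟨z, IntermediateField.subset_adjoin _ _ hz⟩
  rw [← hn] at h1
  have h2 := congrFun (FiniteField.coe_frobeniusAlgEquivOfAlgebraic_iterate (residueSubfield F) E n)
    ⟨z, IntermediateField.subset_adjoin _ _ hz⟩
  have h3 : ((FiniteField.frobeniusAlgEquivOfAlgebraic (residueSubfield F) E ^ (n : ℕ) : E ≃ₐ[_] E) :
      E → E) = (FiniteField.frobeniusAlgEquivOfAlgebraic (residueSubfield F) E)^[n] :=
    AlgEquiv.coe_pow _ _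
  simp only at h1
  rw [h3, h2, ← Nat.card_eq_fintype_card, card_residueSubfield] at h1
  exact h1.symm

/-- The map `γ ↦ γ x` is locally constant, because stabilizers of algebraic elements are open. As
`P` is arbitrary, such sets are closed too. -/
lemma isOpen_setOf_apply (x : PadicAlgCl p) (P : PadicAlgCl p → Prop) :
    IsOpen {γ : AbsGal F | P (γ x)} := by
  rw [isOpen_iff_mem_nhds]
  intro γ hγ
  have h1 : IsOpen ((fun δ => γ * δ) '' (MulAction.stabilizer (AbsGal F) x : Set (AbsGal F))) :=
    isOpenMap_mul_left γ _ (stabilizer_isOpen_of_isIntegral x)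
  refine Filter.mem_of_superset (h1.mem_nhds ⟨1, one_mem _, mul_one γ⟩) ?_
  rintro _ ⟨δ, hδ, rfl⟩
  have hδ' : δ x = x := hδ
  change P (γ (δ x))
  rwa [hδ']

lemma isOpen_setOf_galRes (z : ResidueFieldBar p) (P : ResidueFieldBar p → Prop) :
    IsOpen {γ : AbsGal F | P (galRes F γ z)} := by
  obtain ⟨x, rfl⟩ := IsLocalRing.residue_surjective z
  convert isOpen_setOf_apply (F := F) (x : PadicAlgCl p)
    (fun y => ∃ h : y ∈ IntegerRing p, P (IsLocalRing.residue _ ⟨y, h⟩)) using 2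
  ext γ
  exact ⟨fun h => ⟨gal_mem γ x.2, h⟩, fun ⟨_, h⟩ => h⟩

lemma isClosed_setOf_galRes (z : ResidueFieldBar p) (P : ResidueFieldBar p → Prop) :
    IsClosed {γ : AbsGal F | P (galRes F γ z)} :=
  ⟨isOpen_setOf_galRes z fun y => ¬ P y⟩

lemma isClosed_inertia : IsClosed (inertia F : Set (AbsGal F)) := by
  have h : (inertia F : Set (AbsGal F)) = ⋂ z, {γ | galRes F γ z = z} := by
    ext γ
    rw [Set.mem_iInter]
    exact ⟨fun h z => by rw [Set.mem_ofPred_eq, (MonoidHom.mem_ker).1 h, RingAut.one_apply],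
      fun h => (MonoidHom.mem_ker).2 (RingEquiv.ext h)⟩
  rw [h]
  exact isClosed_iInter fun z => isClosed_setOf_galRes z fun y => y = z

instance : CompactSpace (inertia F) := isCompact_iff_compactSpace.1 isClosed_inertia.isCompact

lemma WeilGroup.IsFrobenius.exists_arithmetic {Φ : WeilGroup F} (hΦ : Φ.IsFrobenius) :
    ∃ ε : ℤ, ∀ z, galRes F (WeilGroup.incl F (Φ ^ ε)) z = z ^ residueCard F := by
  rcases hΦ with h | h
  · exact ⟨1, by simpa using h⟩
  · refine ⟨-1, fun z => ?_⟩
    have := h (galRes F (WeilGroup.incl F (Φ ^ (-1 : ℤ))) z)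
    rw [← RingAut.mul_apply, ← map_mul, ← map_mul] at this
    rw [← this]
    simp

lemma galRes_pow_of_arithmetic {γ : AbsGal F} (h : ∀ z, galRes F γ z =
    z ^ residueCard F) (n : ℕ) (z) :
    galRes F (γ ^ n) z = z ^ residueCard F ^ n := by
  induction n generalizing z with
  | zero => simp
  | succ n ih => rw [pow_succ, map_mul, RingAut.mul_apply, h, ih, ← pow_mul, ← pow_succ']

lemma WeilGroup.IsFrobenius.exists_eq_zpow_mul {Φ : WeilGroup F} (hΦ : Φ.IsFrobenius)
    (w : WeilGroup F) : ∃ (a : ℤ) (x : inertia F), w = Φ ^ a * WeilGroup.ofInertia F x := by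
  obtain ⟨ε, hε⟩ := hΦ.exists_arithmetic
  obtain ⟨m, n, h⟩ := w.2
  -- By `h`, `w` acts as Frobenius to the power `n - m`, so this product acts trivially.
  let x : WeilGroup F := (Φ ^ ε) ^ (m - n : ℤ) * w
  have hx : WeilGroup.incl F x ∈ inertia F := by
    refine (MonoidHom.mem_ker).2 (RingEquiv.ext fun z => ?_)
    have e : (Φ ^ ε) ^ n * x = (Φ ^ ε) ^ m * w := by
      simp only [x]
      rw [← mul_assoc, ← zpow_natCast, ← zpow_natCast, ← zpow_add, add_sub_cancel]
    have e1 : galRes F (WeilGroup.incl F (Φ ^ ε) ^ n) (galRes F (WeilGroup.incl F x) z) =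
        galRes F (WeilGroup.incl F (Φ ^ ε) ^ m) (galRes F (WeilGroup.incl F w) z) := by
      rw [← RingAut.mul_apply, ← RingAut.mul_apply, ← map_mul, ← map_mul, ← map_pow, ← map_pow,
        ← map_mul, ← map_mul, e]
    have e2 : galRes F (WeilGroup.incl F (Φ ^ ε) ^ m) (galRes F (WeilGroup.incl F w) z) =
        galRes F (WeilGroup.incl F (Φ ^ ε) ^ n) z := by
      rw [galRes_pow_of_arithmetic hε, galRes_pow_of_arithmetic hε]
      exact h z
    exact (galRes F (WeilGroup.incl F (Φ ^ ε) ^ n)).injective (e1.trans e2)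
  refine ⟨-(ε * (m - n)), ⟨WeilGroup.incl F x, hx⟩, ?_⟩
  have : WeilGroup.ofInertia F ⟨WeilGroup.incl F x, hx⟩ = x := Subtype.ext rfl
  rw [this]
  simp only [x]
  rw [← zpow_mul, ← mul_assoc, ← zpow_add, neg_add_cancel, zpow_zero, one_mul]

/-- The Weil group is dense in the Galois group. -/
lemma WeilGroup.IsFrobenius.dense_range_incl [FiniteDimensional ℚ_[p] F] {Φ : WeilGroup F}
    (hΦ : Φ.IsFrobenius) : Dense (Set.range (WeilGroup.incl F)) := by
  obtain ⟨ε, hε⟩ := hΦ.exists_arithmetic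
  have hW : Set.range (WeilGroup.incl F) = (WeilGroup.incl F).range := rfl
  rw [hW]
  intro γ
  let C : Set (AbsGal F) := closure (Subgroup.zpowers (WeilGroup.incl F Φ) : Set (AbsGal F))
  -- Powers of `Φ` imitate `γ` on any finite set of residues; compactness gives a `c` in their
  -- closure acting as `γ` on all residues. Then `c⁻¹ * γ` is in inertia, hence in `W`.
  obtain ⟨c, hcC, hc⟩ := (isClosed_closure.isCompact : IsCompact C).inter_iInter_nonempty
    (fun z : ResidueFieldBar p => {c | galRes F c z = galRes F γ z})
    (fun z => isClosed_setOf_galRes z fun y => y = galRes F γ z) (fun T => by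
      obtain ⟨n, hn⟩ := exists_galRes_eq_pow γ T
      refine ⟨WeilGroup.incl F (Φ ^ ε) ^ n, subset_closure ⟨ε * n, ?_⟩, ?_⟩
      · simp [zpow_mul]
      · refine Set.mem_iInter₂.2 fun z hz => ?_
        rw [Set.mem_ofPred_eq, hn z hz, galRes_pow_of_arithmetic hε])
  have hx : c⁻¹ * γ ∈ inertia F := by
    refine (MonoidHom.mem_ker).2 (RingEquiv.ext fun z => ?_)
    have h1 : galRes F c z = galRes F γ z := Set.mem_iInter.1 hc z
    rw [map_mul, RingAut.mul_apply, ← h1, ← RingAut.mul_apply, ← map_mul, inv_mul_cancel, map_one]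
  have h1 : c ∈ (WeilGroup.incl F).range.topologicalClosure :=
    closure_mono (s := (Subgroup.zpowers (WeilGroup.incl F Φ) : Set (AbsGal F)))
      (by rw [SetLike.coe_subset_coe, Subgroup.zpowers_le]; exact ⟨Φ, rfl⟩) hcC
  have h2 : c⁻¹ * γ ∈ (WeilGroup.incl F).range.topologicalClosure :=
    subset_closure ⟨WeilGroup.ofInertia F ⟨_, hx⟩, rfl⟩
  have := mul_mem h1 h2
  rwa [mul_inv_cancel_left] at this

end WeilDensity

/-! ### Integrality of continuous representations, and reduction on a dense subgroup. -/

section CompactGroups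

variable {ℓ : ℕ} [Fact ℓ.Prime] {G V : Type*} [Group G] [AddCommGroup V] [Module (PadicAlgCl ℓ) V]

lemma mem_diagLattice_one {ι : Type*} {b : Module.Basis ι (PadicAlgCl ℓ) V} {x : V} :
    x ∈ diagLattice (IntegerRing ℓ) b 1 ↔ ∀ i, ‖b.repr x i‖ ≤ 1 := by
  refine forall_congr' fun i => ⟨?_, fun h => ⟨⟨_, mem_integerRing.2 h⟩, by simp⟩⟩
  rintro ⟨o, ho⟩
  rw [ho, Pi.one_apply, mul_one]
  exact mem_integerRing.1 o.2

lemma mapsTo_diagLattice_one {ι : Type*} [Finite ι] {b : Module.Basis ι (PadicAlgCl ℓ) V}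
    {L : Submodule (IntegerRing ℓ) V} {f : Module.End (PadicAlgCl ℓ) V} (hf : ∀ j, f (b j) ∈
        L) {x : V}
    (hx : x ∈ diagLattice (IntegerRing ℓ) b 1) : f x ∈ L := by
  rw [← span_eq_diagLattice] at hx
  have : Submodule.span (IntegerRing ℓ) (Set.range fun i => (1 : ι → PadicAlgCl ℓ) i • b i) ≤
      L.comap (f.restrictScalars (IntegerRing ℓ)) := by
    rw [Submodule.span_le]
    rintro _ ⟨j, rfl⟩
    simpa using hf j
  exact this hx

lemma basis_mem_diagLattice_one {ι : Type*} (b : Module.Basis ι (PadicAlgCl ℓ) V) (j : ι) :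
    b j ∈ diagLattice (IntegerRing ℓ) b 1 := by
  classical
  rw [mem_diagLattice_one]
  intro i
  rw [b.repr_self, Finsupp.single_apply]
  split_ifs <;> simp

lemma exists_eq_diagLattice_one {L : Submodule (IntegerRing ℓ) V} (hL : L.IsLattice (PadicAlgCl ℓ)) :
    ∃ (m : ℕ) (b : Module.Basis (Fin m) (PadicAlgCl ℓ) V), L = diagLattice (IntegerRing ℓ) b 1 := by
  obtain ⟨m, b, -, -, h, -⟩ := exists_joint_basis L L hL hL
  exact ⟨m, b, h⟩

variable [TopologicalSpace G]

lemma IsContinuous.isOpen_coeff {σ : Representation (PadicAlgCl ℓ) G V} (hσ : IsContinuous σ)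
    {m : ℕ} (b : Module.Basis (Fin m) (PadicAlgCl ℓ) V) {B : Set (PadicAlgCl ℓ)} (hB : IsOpen B) :
    IsOpen {g | ∀ i j, b.repr (σ g (b j) - b j) i ∈ B} := by
  simp only [Set.ofPred_forall]
  refine isOpen_iInter_of_finite fun i => isOpen_iInter_of_finite fun j => hB.preimage ?_
  have := (hσ (b.coord i) (b j)).sub (continuous_const (y := b.coord i (b j)))
  convert this using 2
  simp

/-- A continuous `ℓ`-adic representation of a compact group is integral. -/
theorem IsContinuous.isIntegral [IsTopologicalGroup G] [CompactSpace G]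
    [FiniteDimensional (PadicAlgCl ℓ) V] {σ : Representation (PadicAlgCl ℓ) G V}
    (hσ : IsContinuous σ) : LAdic.IsIntegral σ := by
  let b := Module.finBasis (PadicAlgCl ℓ) V
  let L₀ := diagLattice (IntegerRing ℓ) b 1
  let U : Set G := {g | ∀ i j, b.repr (σ g (b j) - b j) i ∈ Metric.closedBall 0 1}
  have hU : IsOpen U := hσ.isOpen_coeff b (IsUltrametricDist.isOpen_closedBall _ one_ne_zero)
  have h1U : (1 : G) ∈ U := fun i j => by simp
  have hUL : ∀ g ∈ U, ∀ x ∈ L₀, σ g x ∈ L₀ := fun g hg x hx => by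
    refine mapsTo_diagLattice_one (fun j => ?_) hx
    rw [← sub_add_cancel (σ g (b j)) (b j)]
    refine L₀.add_mem (mem_diagLattice_one.2 fun i => ?_) (basis_mem_diagLattice_one b j)
    exact mem_closedBall_zero_iff.1 (hg i j)
  obtain ⟨t, ht⟩ := CompactSpace.elim_nhds_subcover (fun g : G => {h | g⁻¹ * h ∈ U}) fun g =>
    (hU.preimage (continuous_const_mul g⁻¹)).mem_nhds (by simpa using h1U)
  have ht' : ∀ γ, ∃ g ∈ t, g⁻¹ * γ ∈ U := fun γ => by
    have : γ ∈ ⋃ g ∈ t, {h | g⁻¹ * h ∈ U} := ht ▸ Set.mem_univ γ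
    simpa using this
  -- Since `U` preserves `L₀` and the translates `g U`, for `g` in `t`, cover `G`, this finite sum
  -- contains every `σ γ L₀`; hence it is stable.
  let L : Submodule (IntegerRing ℓ) V := ⨆ g ∈ t, L₀.map ((σ g).restrictScalars (IntegerRing ℓ))
  have hgL : ∀ γ, ∀ x ∈ L₀, σ γ x ∈ L := fun γ x hx => by
    obtain ⟨g, hg, hu⟩ := ht' γ
    refine Submodule.mem_iSup_of_mem g (Submodule.mem_iSup_of_mem hg ⟨σ (g⁻¹ * γ) x,
        hUL _ hu x hx, ?_⟩)
    change σ g (σ (g⁻¹ * γ) x) = σ γ x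
    rw [← Module.End.mul_apply, ← map_mul, mul_inv_cancel_left]
  refine ⟨L, ⟨⟨?_, ?_⟩, fun γ v hv => ?_⟩⟩
  · refine Submodule.fg_biSup _ _ fun g _ => Submodule.FG.map _ ?_
    change (diagLattice (IntegerRing ℓ) b 1).FG
    rw [← span_eq_diagLattice]
    exact Submodule.fg_span (Set.finite_range _)
  · rw [← top_le_iff, ← b.span_eq, Submodule.span_le]
    rintro _ ⟨j, rfl⟩
    refine Submodule.subset_span ?_
    simpa using hgL 1 _ (basis_mem_diagLattice_one b j)
  · have : L ≤ L.comap ((σ γ).restrictScalars (IntegerRing ℓ)) := by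
      refine iSup₂_le fun g _ => ?_
      rintro _ ⟨x, hx, rfl⟩
      change σ γ (σ g x) ∈ L
      rw [← Module.End.mul_apply, ← map_mul]
      exact hgL _ x hx
    exact this hv

/-- Modulo `ℓ`, a continuous representation takes the same values on a dense subgroup. -/
lemma IsContinuous.exists_residualRep_eq [IsTopologicalGroup G] {H : Type*} [Group H]
    {σ : Representation (PadicAlgCl ℓ) G V} (hσ : IsContinuous σ) {L : Submodule (IntegerRing ℓ) V}
    (hL : IsStableLattice σ L) (φ : H →* G) (hφ : Dense (Set.range φ)) (γ : G) :
    ∃ h, residualRep σ L hL γ = residualRep σ L hL (φ h) := by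
  obtain ⟨m, b, rfl⟩ := exists_eq_diagLattice_one hL.isLattice
  -- The elements congruent to `1` modulo the maximal ideal; by density, the open set `γ U` meets
  -- the image of `φ`.
  let U : Set G := {g | ∀ i j, b.repr (σ g (b j) - b j) i ∈ Metric.ball 0 1}
  have hU : IsOpen U := hσ.isOpen_coeff b Metric.isOpen_ball
  obtain ⟨_, hu, ⟨h, rfl⟩⟩ := hφ.inter_open_nonempty {δ | γ⁻¹ * δ ∈ U}
    (hU.preimage (continuous_const_mul γ⁻¹)) ⟨γ, fun i j => by simp⟩
  have h1 : residualRep σ _ hL (γ⁻¹ * φ h) = 1 := by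
    refine LinearMap.ext fun z => ?_
    obtain ⟨x, rfl⟩ := exists_eq_one_tmul z
    rw [← sub_eq_zero]
    change (1 : ResidueFieldBar ℓ) ⊗ₜ[IntegerRing ℓ] latticeRep σ _ hL (γ⁻¹ * φ h) x -
      (1 : ResidueFieldBar ℓ) ⊗ₜ[IntegerRing ℓ] x = 0
    rw [← TensorProduct.tmul_sub, tmul_eq_zero_iff]
    intro i
    choose o ho using x.2
    have hc : ∀ j, ∃ c ∈ IsLocalRing.maximalIdeal (IntegerRing ℓ),
        b.repr (σ (γ⁻¹ * φ h) (b j) - b j) i = algebraMap _ (PadicAlgCl ℓ) c := fun j =>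
      have h2 := mem_ball_zero_iff.1 (hu i j)
      ⟨⟨_, mem_integerRing.2 h2.le⟩, mem_maximalIdeal_integerRing.2 h2, rfl⟩
    choose c hc hc' using hc
    refine ⟨∑ j, o j * c j, Ideal.sum_mem _ fun j _ => Ideal.mul_mem_left _ _ (hc j), ?_⟩
    change b.repr (σ (γ⁻¹ * φ h) (x : V) - (x : V)) i = _
    have hx : σ (γ⁻¹ * φ h) (x : V) - (x : V) =
        ∑ j, b.repr (x : V) j • (σ (γ⁻¹ * φ h) (b j) - b j) := by
      simp only [smul_sub, Finset.sum_sub_distrib, ← map_smul, ← map_sum, b.sum_repr]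
    rw [hx, map_sum, Finsupp.finsetSum_apply, Pi.one_apply, mul_one, map_sum]
    refine Finset.sum_congr rfl fun j _ => ?_
    rw [map_smul, Finsupp.smul_apply, hc', ho, Pi.one_apply, mul_one, smul_eq_mul, map_mul]
  refine ⟨h, ?_⟩
  rw [← mul_inv_cancel_left γ (φ h), map_mul, h1, mul_one]

end CompactGroups

/-! ### Exponentials of nilpotent endomorphisms. -/

section Exponential

variable {k V : Type*} [Field k] [AddCommGroup V] [Module k V]

lemma expNilpotent_eq_sum {N : Module.End k V} {r : ℕ} (hr : N ^ r = 0) :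
    expNilpotent N = ∑ i ∈ Finset.range r, ((i.factorial : k)⁻¹) • N ^ i := by
  refine Finset.sum_subset (Finset.range_mono (csInf_le' hr)) fun i _ hi => ?_
  rw [pow_eq_zero_of_le (by simpa using hi) (pow_nilpotencyClass ⟨r, hr⟩), smul_zero]

variable [CharZero k]

lemma expNilpotent_mul_neg {N : Module.End k V} (hN : IsNilpotent N) :
    expNilpotent N * expNilpotent (-N) = 1 := by
  let _ : Algebra ℚ (Module.End k V) :=
    ((algebraMap k (Module.End k V)).comp (algebraMap ℚ k)).toAlgebra' fun q f =>
      Algebra.commutes (algebraMap ℚ k q) f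
  have key : ∀ M : Module.End k V, expNilpotent M = IsNilpotent.exp M := fun M => by
    refine Finset.sum_congr rfl fun i _ => ?_
    rw [Algebra.smul_def ((i.factorial : ℚ)⁻¹)]
    change _ = algebraMap k (Module.End k V) (algebraMap ℚ k _) * _
    rw [map_inv₀, map_natCast, ← Algebra.smul_def]
  rw [key, key]
  exact IsNilpotent.exp_mul_exp_neg_self hN

/-- If `exp(m s N)` is conjugate to `exp(m s' N)` by the same element for all `m`, then the element
conjugates `s N` to `s' N`. -/
lemma smul_conj_of_expNilpotent {N A : Module.End k V} (hN : IsNilpotent N) {s s' : k}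
    (h : ∀ m : ℕ, A * expNilpotent ((m * s : k) • N) = expNilpotent ((m * s' : k) • N) * A) :
    s • (A * N) = s' • (N * A) := by
  obtain ⟨r, hr⟩ := hN
  -- The bound `r + 2` ensures that the sums below contain the term of degree `1`, even for `r = 0`.
  have hr2 : N ^ (r + 2) = 0 := by rw [pow_add, hr, zero_mul]
  have hexp : ∀ c : k, expNilpotent (c • N) =
      ∑ i ∈ Finset.range (r + 2), ((i.factorial : k)⁻¹) • (c • N) ^ i := fun c =>
    expNilpotent_eq_sum (by rw [smul_pow, hr2, smul_zero])
  rw [← sub_eq_zero, ← Module.forall_dual_apply_eq_zero_iff k]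
  intro f
  -- The value of `P` at `m` is `f` applied to the difference of the two sides of `h m`. Vanishing
  -- at all natural numbers forces `P = 0` in characteristic zero, and its coefficient of degree `1`
  -- is the wanted identity.
  let P : Polynomial k := ∑ i ∈ Finset.range (r + 2), Polynomial.monomial i
    ((i.factorial : k)⁻¹ * (s ^ i * f (A * N ^ i) - s' ^ i * f (N ^ i * A)))
  have hP : P = 0 := by
    refine Polynomial.eq_zero_of_infinite_isRoot P
      ((Set.infinite_range_of_injective (Nat.cast_injective (R := k))).mono ?_)
    rintro _ ⟨m, rfl⟩
    have h1 := congrArg f (h m)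
    rw [hexp, hexp, Finset.mul_sum, Finset.sum_mul, map_sum, map_sum, ← sub_eq_zero,
      ← Finset.sum_sub_distrib] at h1
    change Polynomial.eval _ P = 0
    rw [Polynomial.eval_finsetSum, ← h1]
    refine Finset.sum_congr rfl fun i _ => ?_
    simp only [Polynomial.eval_monomial, smul_pow, mul_smul_comm, smul_mul_assoc, map_smul,
      smul_eq_mul, mul_pow]
    ring
  have h1 := congrArg (fun Q : Polynomial k => Q.coeff 1) hP
  simp only [P, Polynomial.finsetSum_coeff, Polynomial.coeff_monomial, Finset.sum_ite_eq',
    Polynomial.coeff_zero] at h1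
  rw [if_pos (by simp)] at h1
  simpa using h1

end Exponential

/-! ### Smoothness of the Deligne representation. -/

section SmoothPart

variable {p ℓ : ℕ} [Fact p.Prime] [Fact ℓ.Prime] {F : IntermediateField ℚ_[p] (PadicAlgCl p)}
  {V : Type*} [AddCommGroup V] [Module (PadicAlgCl ℓ) V]

lemma isOpen_coset_ofInertia (w : WeilGroup F) {U : Set (inertia F)} (hU : IsOpen U) :
    IsOpen {w' : WeilGroup F | ∃ x ∈ U, w' = w * WeilGroup.ofInertia F x} := by
  obtain ⟨O, hO, rfl⟩ := isOpen_induced_iff.1 hU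
  have h1 : IsOpen (WeilGroup.incl F ⁻¹' ((fun γ => (WeilGroup.incl F w)⁻¹ * γ) ⁻¹' O)) := by
    have : @IsOpen _ (TopologicalSpace.induced (WeilGroup.incl F) inferInstance)
        (WeilGroup.incl F ⁻¹' ((fun γ => (WeilGroup.incl F w)⁻¹ * γ) ⁻¹' O)) :=
      isOpen_induced (hO.preimage (continuous_const_mul _))
    exact inf_le_left (α := TopologicalSpace (WeilGroup F)) _ this
  have h2 : IsOpen ((fun w : WeilGroup F => (w : WeilGroup F ⧸ (WeilGroup.ofInertia F).range)) ⁻¹'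
      {(w : WeilGroup F ⧸ (WeilGroup.ofInertia F).range)}) := by
    have : @IsOpen _ (TopologicalSpace.induced
        (fun w : WeilGroup F => (w : WeilGroup F ⧸ (WeilGroup.ofInertia F).range)) ⊥)
        ((fun w : WeilGroup F => (w : WeilGroup F ⧸ (WeilGroup.ofInertia F).range)) ⁻¹'
          {(w : WeilGroup F ⧸ (WeilGroup.ofInertia F).range)}) :=
      ⟨_, trivial, rfl⟩
    exact inf_le_right (α := TopologicalSpace (WeilGroup F)) _ this
  convert h1.inter h2 using 1
  ext w'
  constructor
  · rintro ⟨x, hx, rfl⟩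
    refine ⟨?_, ?_⟩
    · change (WeilGroup.incl F w)⁻¹ * WeilGroup.incl F (w * WeilGroup.ofInertia F x) ∈ O
      rw [map_mul, inv_mul_cancel_left]
      exact hx
    · have h3 : w⁻¹ * (w * WeilGroup.ofInertia F x) ∈ (WeilGroup.ofInertia F).range :=
        ⟨x, by rw [inv_mul_cancel_left]⟩
      exact (QuotientGroup.eq.2 h3).symm
  · rintro ⟨h, h'⟩
    obtain ⟨x, hx⟩ := QuotientGroup.eq.1 (show (w : WeilGroup F ⧸ (WeilGroup.ofInertia F).range) =
        w' from h'.symm)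
    refine ⟨x, ?_, by rw [hx, mul_inv_cancel_left]⟩
    change (WeilGroup.incl F w)⁻¹ * WeilGroup.incl F w' ∈ O at h
    rw [← map_inv, ← map_mul, ← hx] at h
    exact h

lemma IsDeligneRep.isSmooth {σ : Representation (PadicAlgCl ℓ) (AbsGal F) V}
    {ρ : Representation (PadicAlgCl ℓ) (WeilGroup F) V} {N : Module.End (PadicAlgCl ℓ) V}
    (h : IsDeligneRep σ ρ N) : IsSmooth ρ := by
  obtain ⟨t, Φ, -, -, -, hN, ⟨U, hU, hUN⟩, hρ⟩ := h
  -- On `U` the two exponentials cancel, so each stabilizer is a union of cosets of the open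
  -- subgroup `U`.
  have h1 : ∀ x ∈ U, ρ (WeilGroup.ofInertia F x) = 1 := fun x hx => by
    have h2 := hρ 0 x
    rw [zpow_zero, one_mul] at h2
    rw [h2, neg_smul]
    change σ (x : AbsGal F) * _ = 1
    rw [hUN x hx]
    exact expNilpotent_mul_neg (hN.smul _)
  intro v
  rw [isOpen_iff_mem_nhds]
  intro w hw
  refine Filter.mem_of_superset ((isOpen_coset_ofInertia w hU).mem_nhds
    ⟨1, one_mem U, by rw [map_one, mul_one]⟩) ?_
  rintro _ ⟨x, hx, rfl⟩
  change ρ _ v = v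
  rw [map_mul, h1 x hx, mul_one]
  exact hw

end SmoothPart

/-! ### Conjugation of the monodromy operator by the Galois group. -/

section Conjugation

variable {p ℓ : ℕ} [Fact p.Prime] [Fact ℓ.Prime] {F : IntermediateField ℚ_[p] (PadicAlgCl p)}
  {V : Type*} [AddCommGroup V] [Module (PadicAlgCl ℓ) V]

lemma norm_tameValue_le (t : inertia F →* Multiplicative ℤ_[ℓ]) (x : inertia F) :
    ‖tameValue t x‖ ≤ 1 := by
  rw [tameValue, norm_algebraMap']
  exact PadicInt.norm_le_one _

lemma tameValue_pow (t : inertia F →* Multiplicative ℤ_[ℓ]) (x : inertia F) (m : ℕ) :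
    tameValue t (x ^ m) = m * tameValue t x := by
  simp [tameValue]

/-- Take `y` in inertia with `t y = 1` and its conjugate `y'` by `γ`. Inertia is compact, so `U` has
finite index and contains the powers of both with exponents `m k k'`. There `σ` is exponential, and
`smul_conj_of_expNilpotent` extracts the linear terms; `c` is the value of `t` at `y'`. -/
lemma IsDeligneRep.exists_conj {σ : Representation (PadicAlgCl ℓ) (AbsGal F) V}
    {ρ : Representation (PadicAlgCl ℓ) (WeilGroup F) V} {N : Module.End (PadicAlgCl ℓ) V}
    (h : IsDeligneRep σ ρ N) (γ : AbsGal F) : ∃ c : PadicAlgCl ℓ, σ γ * N = c • (N * σ γ) := by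
  obtain ⟨t, Φ, -, ht, -, hN, ⟨U, hU, hUN⟩, -⟩ := h
  have : Finite (inertia F ⧸ U) := Subgroup.quotient_finite_of_isOpen U hU
  have hind : U.index ≠ 0 := Subgroup.index_ne_zero_of_finite
  obtain ⟨y, hy⟩ := ht (Multiplicative.ofAdd 1)
  have hnorm : (inertia F).Normal := by unfold inertia; infer_instance
  let y' : inertia F := ⟨γ * y * γ⁻¹, hnorm.conj_mem _ y.2 γ⟩
  obtain ⟨k, hk, -, hyk⟩ := Subgroup.exists_pow_mem_of_index_ne_zero hind y
  obtain ⟨k', hk', -, hyk'⟩ := Subgroup.exists_pow_mem_of_index_ne_zero hind y'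
  have hy1 : tameValue t y = 1 := by simp [tameValue, hy]
  have hyU : ∀ m : ℕ, y ^ (m * (k * k')) ∈ U := fun m => by
    rw [mul_comm, mul_assoc, pow_mul]; exact U.pow_mem hyk _
  have hyU' : ∀ m : ℕ, y' ^ (m * (k * k')) ∈ U := fun m => by
    rw [← mul_assoc, mul_comm, pow_mul]; exact U.pow_mem hyk' _
  have hconj : ∀ m : ℕ, γ * ((y ^ m : inertia F) : AbsGal F) =
      ((y' ^ m : inertia F) : AbsGal F) * γ := by
    intro m
    simp [y', conj_pow]
  have key := smul_conj_of_expNilpotent (A := σ γ) hN (s := ((k * k' : ℕ) : PadicAlgCl ℓ))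
    (s' := ((k * k' : ℕ) : PadicAlgCl ℓ) * tameValue t y') (fun m => by
      have h1 := hUN _ (hyU m)
      have h2 := hUN _ (hyU' m)
      rw [tameValue_pow, hy1, mul_one, Nat.cast_mul] at h1
      rw [tameValue_pow, Nat.cast_mul, mul_assoc] at h2
      rw [← h1, ← h2, ← map_mul, ← map_mul, hconj])
  have h0 : ((k * k' : ℕ) : PadicAlgCl ℓ) ≠ 0 := by
    rw [Nat.cast_ne_zero]; positivity
  rw [mul_smul] at key
  exact ⟨tameValue t y', smul_right_injective _ h0 key⟩

/-- A scalar by which a bounded group of operators scales a nonzero operator is integral. -/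
lemma norm_le_one_of_conj {A N : Module.End (PadicAlgCl ℓ) V} {L : Submodule (IntegerRing ℓ) V}
    (hL : L.IsLattice (PadicAlgCl ℓ)) {B : Module.End (PadicAlgCl ℓ) V} (hAB : A * B = 1)
    (hA : ∀ x ∈ L, A x ∈ L) (hB : ∀ x ∈ L, B x ∈ L) {c : PadicAlgCl ℓ} (hc : A * N = c • (N * A))
    (hN : N ≠ 0) : ‖c‖ ≤ 1 := by
  obtain ⟨m, b, rfl⟩ := exists_eq_diagLattice_one hL
  obtain ⟨j, hj⟩ : ∃ j, N (b j) ≠ 0 := by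
    by_contra! h
    exact hN (b.ext fun j => by rw [h j]; rfl)
  obtain ⟨i, hi⟩ : ∃ i, b.repr (N (b j)) i ≠ 0 := by
    by_contra! h
    exact hj (b.repr.map_eq_zero_iff.1 (Finsupp.ext h))
  obtain ⟨⟨d, hd⟩, hdN⟩ := IsLocalization.exist_integer_multiples_of_finite
    (nonZeroDivisors (IntegerRing ℓ)) fun q : Fin m × Fin m => b.repr (N (b q.1)) q.2
  have hd0 : (d : PadicAlgCl ℓ) ≠ 0 := by
    simpa using nonZeroDivisors.ne_zero hd
  have hNL : ∀ x ∈ diagLattice (IntegerRing ℓ) b 1, (d : PadicAlgCl ℓ) • N x ∈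
      diagLattice (IntegerRing ℓ) b 1 := by
    intro x hx
    refine mapsTo_diagLattice_one (f := (d : PadicAlgCl ℓ) • N) (fun j => ?_) hx
    rw [mem_diagLattice_one]
    intro i
    obtain ⟨o, ho⟩ := hdN (j, i)
    rw [LinearMap.smul_apply, map_smul, Finsupp.smul_apply]
    refine mem_integerRing.1 ?_
    convert o.2 using 1
    exact ho.symm
  have hpow : ∀ n : ℕ, A ^ n * N = c ^ n • (N * A ^ n) := by
    intro n
    induction n with
    | zero => simp
    | succ n ih =>
      rw [pow_succ, mul_assoc, hc, mul_smul_comm, ← mul_assoc, ih, smul_mul_assoc, smul_smul,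
          mul_assoc,
        ← pow_succ']
  have hAn : ∀ (n : ℕ), ∀ x ∈ diagLattice (IntegerRing ℓ) b 1, (A ^ n) x ∈
      diagLattice (IntegerRing ℓ) b 1 := by
    intro n
    induction n with
    | zero => exact fun x hx => hx
    | succ n ih => exact fun x hx => by rw [pow_succ]; exact ih _ (hA x hx)
  have hBn : ∀ (n : ℕ), ∀ x ∈ diagLattice (IntegerRing ℓ) b 1, (B ^ n) x ∈
      diagLattice (IntegerRing ℓ) b 1 := by
    intro n
    induction n with
    | zero => exact fun x hx => hx
    | succ n ih => exact fun x hx => by rw [pow_succ]; exact ih _ (hB x hx)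
  have hABn : ∀ n : ℕ, A ^ n * B ^ n = 1 := by
    intro n
    induction n with
    | zero => simp
    | succ n ih => rw [pow_succ, pow_succ', mul_assoc, ← mul_assoc A, hAB, one_mul, ih]
  -- The operator `A ^ n * (d N) * B ^ n = c ^ n d N` preserves the lattice for every `n`, while `N`
  -- has a nonzero matrix entry; so the powers of `c` are bounded.
  have hbound : ∀ n : ℕ, ‖c‖ ^ n * (‖(d : PadicAlgCl ℓ)‖ * ‖b.repr (N (b j)) i‖) ≤ 1 := by
    intro n
    have h1 := hAn n _ (hNL _ (hBn n _ (basis_mem_diagLattice_one b j)))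
    have h2 : (A ^ n) ((d : PadicAlgCl ℓ) • N ((B ^ n) (b j))) =
        c ^ n • (d : PadicAlgCl ℓ) • N (b j) := by
      have h3 := LinearMap.congr_fun (hpow n) ((B ^ n) (b j))
      have h4 := LinearMap.congr_fun (hABn n) (b j)
      simp only [Module.End.mul_apply, LinearMap.smul_apply, Module.End.one_apply] at h3 h4
      rw [map_smul, h3, h4, smul_comm]
    rw [h2, mem_diagLattice_one] at h1
    simpa using h1 i
  by_contra! hc1
  have hpos : 0 < ‖(d : PadicAlgCl ℓ)‖ * ‖b.repr (N (b j)) i‖ := by positivity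
  obtain ⟨n, hn⟩ := pow_unbounded_of_one_lt (‖(d : PadicAlgCl ℓ)‖ * ‖b.repr (N (b j)) i‖)⁻¹ hc1
  have := (inv_lt_iff_one_lt_mul₀ hpos).1 hn
  linarith [hbound n]

end Conjugation

/-! ### A lattice on which the exponentials are trivial modulo `ℓ`. -/

section CommonLattice

variable {p ℓ : ℕ} [Fact p.Prime] [Fact ℓ.Prime] {G V : Type*} [Group G] [AddCommGroup V]
  [Module (PadicAlgCl ℓ) V]

lemma norm_natCast_le_one (n : ℕ) : ‖(n : PadicAlgCl ℓ)‖ ≤ 1 :=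
  mem_integerRing.1 (natCast_mem _ n)

/-- A lattice stable under `σ` on which `exp(sN)` acts trivially modulo `ℓ`,
    for all integral `s`. -/
lemma exists_stable_lattice_exp {σ : Representation (PadicAlgCl ℓ) G V} (hσ : LAdic.IsIntegral σ)
    {N : Module.End (PadicAlgCl ℓ) V} (hN : IsNilpotent N)
    (hc : ∀ g, ∃ c : PadicAlgCl ℓ, ‖c‖ ≤ 1 ∧ σ g * N = c • (N * σ g)) :
    ∃ L : Submodule (IntegerRing ℓ) V, IsStableLattice σ L ∧
      ∀ s : PadicAlgCl ℓ, ‖s‖ ≤ 1 → ∀ v ∈ L, ∃ y ∈ L, expNilpotent (s • N) v =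
          v + (ℓ : PadicAlgCl ℓ) • y := by
  obtain ⟨L₀, hL₀⟩ := hσ
  obtain ⟨r, hr⟩ := hN
  -- With `N = μ D`, the factor `r!` absorbs the denominators of the exponential series and a factor
  -- `ℓ` is left over.
  let μ : PadicAlgCl ℓ := ℓ * r.factorial
  have hμ : μ ≠ 0 := mul_ne_zero (Nat.cast_ne_zero.2 (Fact.out : ℓ.Prime).ne_zero)
    (Nat.cast_ne_zero.2 r.factorial_ne_zero)
  let D : Module.End (PadicAlgCl ℓ) V := μ⁻¹ • N
  have hDr : D ^ r = 0 := by rw [smul_pow, hr, smul_zero]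
  let L : Submodule (IntegerRing ℓ) V :=
    L₀ ⊔ ⨆ i ∈ Finset.range r, L₀.map ((D ^ i).restrictScalars (IntegerRing ℓ))
  have hle : ∀ i, ∀ x ∈ L₀, (D ^ i) x ∈ L := fun i x hx => by
    by_cases hi : i < r
    · exact Submodule.mem_sup_right (Submodule.mem_iSup_of_mem i
        (Submodule.mem_iSup_of_mem (Finset.mem_range.2 hi) ⟨x, hx, rfl⟩))
    · rw [pow_eq_zero_of_le (not_lt.1 hi) hDr]
      exact L.zero_mem
  have hind : ∀ X : Submodule (IntegerRing ℓ) V, (∀ i, ∀ x ∈ L₀, (D ^ i) x ∈ X) → L ≤ X :=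
      fun X hX => by
    refine sup_le (fun x hx => by simpa using hX 0 x hx) (iSup₂_le fun i _ => ?_)
    rintro _ ⟨x, hx, rfl⟩
    exact hX i x hx
  have hint : ∀ c : PadicAlgCl ℓ, ‖c‖ ≤ 1 → ∀ x ∈ L, c • x ∈ L := fun c hc x hx =>
    L.smul_mem (⟨c, mem_integerRing.2 hc⟩ : IntegerRing ℓ) hx
  have hDL : ∀ i, ∀ x ∈ L, (D ^ i) x ∈ L := fun i x hx =>
    hind (L.comap ((D ^ i).restrictScalars (IntegerRing ℓ))) (fun j y hy => by
      change (D ^ i) ((D ^ j) y) ∈ L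
      rw [← Module.End.mul_apply, ← pow_add]
      exact hle _ y hy) hx
  refine ⟨L, ⟨⟨?_, ?_⟩, ?_⟩, ?_⟩
  · exact hL₀.isLattice.fg.sup (Submodule.fg_biSup _ _ fun i _ => hL₀.isLattice.fg.map _)
  · rw [← top_le_iff, ← hL₀.isLattice.span_eq_top]
    exact Submodule.span_mono (le_sup_left (a := L₀))
  · intro g v hv
    obtain ⟨c, hc, hcN⟩ := hc g
    have hpow : ∀ i : ℕ, σ g * D ^ i = c ^ i • (D ^ i * σ g) := by
      intro i
      induction i with
      | zero => simp
      | succ i ih =>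
        have h1 : σ g * D = c • (D * σ g) := by
          simp only [D, mul_smul_comm, smul_mul_assoc, hcN]
          rw [smul_comm]
        rw [pow_succ, ← mul_assoc, ih, smul_mul_assoc, mul_assoc, h1, mul_smul_comm, smul_smul,
          ← pow_succ, mul_assoc]
    -- Moving `σ g` past `D ^ i` costs only `c ^ i`, which is integral because `‖c‖ ≤ 1`.
    refine hind (L.comap ((σ g).restrictScalars (IntegerRing ℓ))) (fun i x hx => ?_) hv
    have h1 := LinearMap.congr_fun (hpow i) x
    change σ g ((D ^ i) x) ∈ L
    rw [Module.End.mul_apply] at h1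
    rw [h1]
    exact hint _ (by rw [norm_pow]; exact pow_le_one₀ (norm_nonneg _) hc) _
      (hle i _ (hL₀.stable g x hx))
  · intro s hs v hv
    -- Summing over `r + 1` terms leaves the degrees `i + 1 ≤ r` once the identity is split off, so
    -- that `(i + 1)!` divides `r!`.
    have hsN : (s • N) ^ (r + 1) = 0 := by rw [smul_pow, pow_succ N, hr, zero_mul, smul_zero]
    have hcoef : ∀ i ∈ Finset.range r, ∃ o : PadicAlgCl ℓ, ‖o‖ ≤ 1 ∧
        (((i + 1).factorial : PadicAlgCl ℓ)⁻¹) • (s • N) ^ (i + 1) =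
          (ℓ : PadicAlgCl ℓ) • o • D ^ (i + 1) := by
      intro i hi
      obtain ⟨d, hd⟩ := Nat.factorial_dvd_factorial (Nat.succ_le_of_lt (Finset.mem_range.1 hi))
      have hi0 : ((i + 1).factorial : PadicAlgCl ℓ) ≠ 0 :=
          Nat.cast_ne_zero.2 (Nat.factorial_ne_zero _)
      -- Here `d = r! / (i + 1)!`, so `μ ^ (i + 1) / (i + 1)! = ℓ * μ ^ i * d`.
      refine ⟨μ ^ i * d * s ^ (i + 1), ?_, ?_⟩
      · rw [norm_mul, norm_mul, norm_pow, norm_pow]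
        have h1 : ‖μ‖ ≤ 1 := by
          have := norm_natCast_le_one (ℓ := ℓ) (ℓ * r.factorial)
          rwa [Nat.cast_mul] at this
        exact mul_le_one₀ (mul_le_one₀ (pow_le_one₀ (norm_nonneg _) h1) (norm_nonneg _)
          (norm_natCast_le_one d)) (by positivity) (pow_le_one₀ (norm_nonneg _) hs)
      · have hμd : μ = ℓ * ((i + 1).factorial * d) := by
          simp only [μ]; rw [hd]; push_cast; ring
        simp only [D, smul_pow, smul_smul]
        congr 1
        have : (ℓ : PadicAlgCl ℓ) * (μ ^ i * d * s ^ (i + 1) * μ⁻¹ ^ (i + 1)) =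
            (ℓ * d * μ⁻¹) * (μ ^ i * μ⁻¹ ^ i) * s ^ (i + 1) := by ring
        rw [this, ← mul_pow, mul_inv_cancel₀ hμ, one_pow, mul_one]
        congr 1
        rw [eq_mul_inv_iff_mul_eq₀ hμ, hμd]
        field_simp
    choose! o ho ho' using hcoef
    refine ⟨∑ i ∈ Finset.range r, o i • (D ^ (i + 1)) v,
      L.sum_mem fun i hi => hint _ (ho i hi) _ (hDL _ v hv), ?_⟩
    rw [expNilpotent_eq_sum hsN, Finset.sum_range_succ', LinearMap.add_apply, add_comm,
      Finset.sum_congr rfl ho', LinearMap.sum_apply, Finset.smul_sum]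
    simp

end CommonLattice

end LAdic

end

/-! ### Comparison of the two reductions. -/

open LAdic in
theorem corollary7p4 {p ℓ : ℕ} [Fact p.Prime] [Fact ℓ.Prime] (hpℓ : ℓ ≠ p)
    (F : IntermediateField ℚ_[p] (PadicAlgCl p)) [FiniteDimensional ℚ_[p] F]
    {V : Type*} [AddCommGroup V] [Module (PadicAlgCl ℓ) V] [FiniteDimensional (PadicAlgCl ℓ) V]
    (σ : Representation (PadicAlgCl ℓ) (AbsGal F) V) (hσ : IsContinuous σ)
    (ρ : Representation (PadicAlgCl ℓ) (WeilGroup F) V) (N : Module.End (PadicAlgCl ℓ) V)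
    (hρ : IsDeligneRep σ ρ N) :
    IsSmooth ρ ∧ LAdic.IsIntegral ρ ∧ LAdic.IsIntegral σ ∧
      ∀ {M M' : Type*} [AddCommGroup M] [Module (ResidueFieldBar ℓ) M]
        [AddCommGroup M'] [Module (ResidueFieldBar ℓ) M']
        (τ : Representation (ResidueFieldBar ℓ) (AbsGal F) M)
        (τ' : Representation (ResidueFieldBar ℓ) (WeilGroup F) M'),
        IsReduction σ τ →
          (IsReduction ρ τ' ↔
            Nonempty (Representation.Equiv τ' (τ.comp (WeilGroup.incl F)))) := by
  have hσi : LAdic.IsIntegral σ := hσ.isIntegral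
  have hc : ∀ γ, ∃ c : PadicAlgCl ℓ, ‖c‖ ≤ 1 ∧ σ γ * N = c • (N * σ γ) := by
    intro γ
    by_cases hN : N = 0
    · exact ⟨0, by simp, by simp [hN]⟩
    obtain ⟨c, hc⟩ := hρ.exists_conj γ
    obtain ⟨L, hL⟩ := hσi
    refine ⟨c, norm_le_one_of_conj hL.isLattice (B :=
        σ γ⁻¹) ?_ (hL.stable γ) (hL.stable γ⁻¹) hc hN, hc⟩
    rw [← map_mul, mul_inv_cancel, map_one]
  have hsmooth := hρ.isSmooth
  obtain ⟨t, Φ, -, -, hΦ, hN, -, hρσ⟩ := hρ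
  obtain ⟨L, hL, hexp⟩ := exists_stable_lattice_exp hσi hN hc
  have hℓ : (ℓ : IntegerRing ℓ) ∈ IsLocalRing.maximalIdeal (IntegerRing ℓ) := by
    rw [mem_maximalIdeal_integerRing]
    have h1 : ‖((ℓ : ℚ_[ℓ]) : PadicAlgCl ℓ)‖ = ‖(ℓ : ℚ_[ℓ])‖ := PadicAlgCl.norm_extends ℓ _
    rw [map_natCast] at h1
    change ‖((ℓ : IntegerRing ℓ) : PadicAlgCl ℓ)‖ < 1
    push_cast
    rw [h1]
    exact Padic.norm_p_lt_one
  -- Write `w = Φ ^ a x`. Then `ρ w` is `σ w` times `exp(-t(x) N)`, which is `1` modulo `ℓ` on `L`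
  -- because `t(x)` is integral.
  have hdiff : ∀ w, ∀ v ∈ L, ∃ y ∈ L, ρ w v =
      σ (WeilGroup.incl F w) v + (ℓ : IntegerRing ℓ) • y := by
    intro w v hv
    obtain ⟨a, x, rfl⟩ := hΦ.exists_eq_zpow_mul w
    obtain ⟨y, hy, hy'⟩ :=
        hexp (-tameValue t x) (by rw [norm_neg]; exact norm_tameValue_le t x) v hv
    refine ⟨_, hL.stable (WeilGroup.incl F (Φ ^ a * WeilGroup.ofInertia F x)) y hy, ?_⟩
    rw [hρσ, Module.End.mul_apply, hy', map_add, map_smul]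
    rfl
  have hLρ : IsStableLattice ρ L := ⟨hL.isLattice, fun w v hv => by
    obtain ⟨y, hy, h⟩ := hdiff w v hv
    rw [h]
    exact L.add_mem (hL.stable _ v hv) (L.smul_mem _ hy)⟩
  have hres : residualRep ρ L hLρ = (residualRep σ L hL).comp (WeilGroup.incl F) := by
    refine MonoidHom.ext fun w => LinearMap.ext fun z => ?_
    obtain ⟨x, rfl⟩ := exists_eq_one_tmul z
    obtain ⟨y, hy, h⟩ := hdiff w x x.2
    have h1 : latticeRep ρ L hLρ w x =
        latticeRep σ L hL (WeilGroup.incl F w) x + (ℓ : IntegerRing ℓ) • ⟨y, hy⟩ := Subtype.ext h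
    change (1 : ResidueFieldBar ℓ) ⊗ₜ[IntegerRing ℓ] latticeRep ρ L hLρ w x =
      (1 : ResidueFieldBar ℓ) ⊗ₜ[IntegerRing ℓ] latticeRep σ L hL (WeilGroup.incl F w) x
    rw [h1, TensorProduct.tmul_add, (one_tmul_eq_zero_iff _).2 (Submodule.smul_mem_smul hℓ trivial),
      add_zero]
  refine ⟨hsmooth, ⟨L, hLρ⟩, hσi, ?_⟩
  rintro M M' _ _ _ _ τ τ' ⟨L₁, hL₁, hτ⟩
  -- Move `τ` from the given lattice `L₁` to `L`, then restrict to `W`, which by density has the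
  -- same image as `Γ` on the reduction of `L`.
  have h1 : IsSemisimplificationRep (residualRep ρ L hLρ) (τ.comp (WeilGroup.incl F)) := by
    rw [hres]
    exact ((isSemisimplificationRep_residualRep_iff σ hL₁ hL τ).1 hτ).comp _
      (hσ.exists_residualRep_eq hL _ hΦ.dense_range_incl)
  constructor
  · rintro ⟨L₂, hL₂, hτ'⟩
    exact nonempty_equiv_iff.2 (IsSemisimplification.nonempty_equiv
      ((isSemisimplificationRep_residualRep_iff ρ hL₂ hLρ τ').1 hτ') h1)
  · intro e
    obtain ⟨e⟩ := nonempty_equiv_iff.1 e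
    exact ⟨L, hLρ, IsSemisimplification.congr h1 e⟩
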